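/- For $r\ge 1$, positive integers $k_1,\dots,k_r$ and signs $\sigma_1,\dots,\sigma_r\in\{\pm1\}$ with $(k_1,\sigma_1)\neq(1,1)$, put $$T^{\sigma_1,\dots,\sigma_r}(k_1,\dots,k_r)=\lim_{n\to\infty}\sum \prod_{i=1}^{r}\frac{2\,\sigma_i^{\nu_i}}{a_i^{k_i}},\qquad a_i=\begin{cases}2\nu_i-1,& r-i \text{ even},\\ 2\nu_i,& r-i\text{ odd},\end{cases}$$ $$S^{\sigma_1,\dots,\sigma_r}(k_1,\dots,k_r)=\lim_{n\to\infty}\sum \prod_{i=1}^{r}\frac{2\,\sigma_i^{\nu_i}}{b_i^{k_i}},\qquad b_i=\begin{cases}2\nu_i,& r-i \text{ even},\\ 2\nu_i-1,& r-i\text{ odd},\end{cases}$$ where the first sum runs over all positive integers $\nu_1,\dots,\nu_r$ with $2n>a_1>a_2>\cdots>a_r>0$ and the second over all positive integers $\nu_1,\dots,\nu_r$ with $2n>b_1>b_2>\cdots>b_r>0$. A bar over the component $k_i$ means $\sigma_i=-1$ and no bar means $\sigma_i=1$; $\{1\}_p$ denotes $p$ consecutive components equal to $1$. Let $\zeta$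 be the Riemann zeta function and $\beta(k)=\sum_{n\ge1}(-1)^{n-1}/(2n-1)^k$. Then for every integer $m\ge1$ the limits defining $S(2,\{1\}_{2m-2},\bar1)$ and $T(2,\{1\}_{2m-1},\bar1)$ exist, and $$S(2,\{1\}_{2m-2},\bar1),\ T(2,\{1\}_{2m-1},\bar1)\in\mathbb{Q}[\log 2,\pi,\zeta(2),\beta(2),\zeta(3),\beta(3),\zeta(4),\dots],$$ that is, both numbers are polynomials with rational coefficients in $\log 2$, $\pi$, the values $\zeta(k)$ $(k\ge2)$ and the values $\beta(k)$ $(k\ge2)$. -/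

import Mathlib

open Filter Topology

noncomputable section

/-- The index set `D_{n,r}`: the tuples `(ν₁, …, ν_r)` of positive integers with
`n ≥ ν₁ > ν₂ ≥ ν₃ > ⋯ > ν_{r-1} ≥ ν_r > 0` if `r` is odd, and
`n > ν₁ ≥ ν₂ > ν₃ ≥ ⋯ > ν_{r-1} ≥ ν_r > 0` if `r` is even.
Positions are counted from `0`: the entry `ν i` is `ν_{i+1}`. -/
def indexD (n r : ℕ) : Finset (Fin r → ℕ) :=
  open Classical in
  (Fintype.piFinset fun _ : Fin r => Finset.Icc 1 n).filter fun ν =>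
    (∀ h : 0 < r, Even r → ν ⟨0, h⟩ < n) ∧
    ∀ (i : ℕ) (h : i + 1 < r),
      if Odd (r - i) then ν ⟨i + 1, h⟩ < ν ⟨i, by omega⟩
      else ν ⟨i + 1, h⟩ ≤ ν ⟨i, by omega⟩

/-- The index set `E_{n,r}`: the tuples `(ν₁, …, ν_r)` of positive integers with
`n > ν₁ ≥ ν₂ > ν₃ ≥ ⋯ ≥ ν_{r-1} > ν_r > 0` if `r` is odd, and
`n ≥ ν₁ > ν₂ ≥ ν₃ > ⋯ ≥ ν_{r-1} > ν_r > 0` if `r` is even. -/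
def indexE (n r : ℕ) : Finset (Fin r → ℕ) :=
  open Classical in
  (Fintype.piFinset fun _ : Fin r => Finset.Icc 1 n).filter fun ν =>
    (∀ h : 0 < r, Odd r → ν ⟨0, h⟩ < n) ∧
    ∀ (i : ℕ) (h : i + 1 < r),
      if Even (r - i) then ν ⟨i + 1, h⟩ < ν ⟨i, by omega⟩
      else ν ⟨i + 1, h⟩ ≤ ν ⟨i, by omega⟩

/-- Alternating multiple `T`-harmonic sum. An argument `L = [(k₁, σ₁), …, (k_r, σ_r)]` lists the
components `k_j` with their signs `σ_j = ±1` (sign `-1` is a bar over `k_j`).  The factors of the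
denominator are alternately `2ν - 1` and `2ν`, the last one being `2ν_r - 1`. -/
def altTSum (L : List (ℕ × ℤˣ)) (n : ℕ) : ℝ :=
  ∑ ν ∈ indexD n L.length, ∏ i : Fin L.length,
    2 * (((L.get i).2 : ℤ) : ℝ) ^ ν i /
      (if Odd (L.length - (i : ℕ)) then 2 * (ν i : ℝ) - 1 else 2 * (ν i : ℝ)) ^ (L.get i).1

/-- Alternating multiple `S`-harmonic sum.  The factors of the denominator are alternately
`2ν - 1` and `2ν`, the last one being `2ν_r`. -/
def altSSum (L : List (ℕ × ℤˣ)) (n : ℕ) : ℝ :=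
  ∑ ν ∈ indexE n L.length, ∏ i : Fin L.length,
    2 * (((L.get i).2 : ℤ) : ℝ) ^ ν i /
      (if Even (L.length - (i : ℕ)) then 2 * (ν i : ℝ) - 1 else 2 * (ν i : ℝ)) ^ (L.get i).1

/-- Alternating multiple `T`-value: the limit of the alternating multiple `T`-harmonic sums. -/
def altT (L : List (ℕ × ℤˣ)) : ℝ := limUnder atTop (altTSum L)

/-- Alternating multiple `S`-value: the limit of the alternating multiple `S`-harmonic sums. -/
def altS (L : List (ℕ × ℤˣ)) : ℝ := limUnder atTop (altSSum L)

/-- The Dirichlet beta value `β(k) = ∑_{n ≥ 0} (-1)^n / (2n+1)^k`, used for `k ≥ 2`, where the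
series converges absolutely. -/
def dirichletBeta (k : ℕ) : ℝ := ∑' n : ℕ, (-1 : ℝ) ^ n / (2 * (n : ℝ) + 1) ^ k

/-- The ring `ℚ[log 2, π, ζ(2), β(2), ζ(3), β(3), ζ(4), …]` of polynomial expressions with
rational coefficients, as a `ℚ`-subalgebra of `ℝ`. -/
def logPiZetaBetaRing : Subalgebra ℚ ℝ :=
  Algebra.adjoin ℚ
    ({Real.log 2, Real.pi}
      ∪ {x : ℝ | ∃ k : ℕ, 2 ≤ k ∧ (x : ℂ) = riemannZeta (k : ℂ)}
      ∪ {x : ℝ | ∃ k : ℕ, 2 ≤ k ∧ x = dirichletBeta k})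

end

/-! Idea. Index each sum by its denominators instead of the `ν`'s: they form a strictly decreasing
chain of alternating parity. With `e = 0` for `T` and `e = 1` for `S`, put the power series of the
tail `({1}_j, \bar 1)` at `y = tanh (p / 2)`. As `2 dy / (1 - y²) = dp`, prefixing a component 1 is
integration in `p`, and the innermost barred 1 gives the kernel `K(q) = tanh(q/2)^e / cosh q`, up to
sign. As `dy / y = dp / sinh p`, the outer component 2 turns the value into `-∫₀^∞ F(p) / sinh p
dp`, where by Cauchy's formula `F(p) = (1/k!) ∫₀^p (p-q)^k K(q) dq` and `k = j + 1`
(`hasSum_iterKernel`, `hasSum_altCoeff_two`, `iterKernel_eq`).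

The parity `(-1)^k = (-1)^e` is decisive. Since `K(-q) = (-1)^e K(q)`, the incomplete convolution
`F` becomes a combination of complete half-line integrals (`two_mul_integral_sub_pow`): a polynomial
in `p` whose coefficients are moments of `K`, and `∫₀^∞ x^k (K(x-p) - K(x+p)) dx`. Divided by `sinh
p` and integrated, the polynomial gives products of moments (`integral_separated`). In the other
part the addition formulas simplify `(K(x-p) - K(x+p)) / sinh p` so that its `p`-integral is
elementary (`reflected_kernel_zero`, `reflected_kernel_one`); swapping the integrals leaves single
moments again.

The moments of `1 / sinh` are zeta values and those of `1 / cosh` are beta values, up to rational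
factors; `log 2` enters as the zeroth moment of `K` for `e = 1`, and `π` as the integral of `1 /
cosh` over the line. -/

open MeasureTheory Set

/-! ### Common form of the two families of sums -/

/-- The common form of `indexD` (`e = 0`) and `indexE` (`e = 1`). -/
noncomputable def altIndex (e n r : ℕ) : Finset (Fin r → ℕ) :=
  open Classical in
  (Fintype.piFinset fun _ : Fin r => Finset.Icc 1 n).filter fun ν =>
    (∀ h : 0 < r, Even (r + e) → ν ⟨0, h⟩ < n) ∧
    ∀ (i : ℕ) (h : i + 1 < r),
      if Odd (r - i + e) then ν ⟨i + 1, h⟩ < ν ⟨i, by omega⟩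
      else ν ⟨i + 1, h⟩ ≤ ν ⟨i, by omega⟩

/-- The common form of `altTSum` (`e = 0`) and `altSSum` (`e = 1`). -/
noncomputable def altSum (e : ℕ) (L : List (ℕ × ℤˣ)) (n : ℕ) : ℝ :=
  ∑ ν ∈ altIndex e n L.length, ∏ i : Fin L.length,
    2 * (((L.get i).2 : ℤ) : ℝ) ^ ν i /
      (if Odd (L.length - (i : ℕ) + e) then 2 * (ν i : ℝ) - 1 else 2 * (ν i : ℝ)) ^ (L.get i).1

theorem mem_altIndex {e n r : ℕ} {ν : Fin r → ℕ} :
    ν ∈ altIndex e n r ↔ (∀ i, 1 ≤ ν i ∧ ν i ≤ n) ∧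
      (∀ h : 0 < r, Even (r + e) → ν ⟨0, h⟩ < n) ∧
      ∀ (i : ℕ) (h : i + 1 < r),
        if Odd (r - i + e) then ν ⟨i + 1, h⟩ < ν ⟨i, by omega⟩
        else ν ⟨i + 1, h⟩ ≤ ν ⟨i, by omega⟩ := by
  simp [altIndex, Finset.mem_filter, Fintype.mem_piFinset, Finset.mem_Icc]

theorem indexD_eq_altIndex (n r : ℕ) : indexD n r = altIndex 0 n r := by
  ext ν
  simp only [mem_altIndex, indexD, Finset.mem_filter, Fintype.mem_piFinset, Finset.mem_Icc]
  refine and_congr_right fun _ => and_congr Iff.rfl ?_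
  refine forall₂_congr fun i h => ?_
  rw [add_zero]

theorem indexE_eq_altIndex (n r : ℕ) : indexE n r = altIndex 1 n r := by
  ext ν
  simp only [mem_altIndex, indexE, Finset.mem_filter, Fintype.mem_piFinset, Finset.mem_Icc]
  refine and_congr_right fun _ => and_congr ?_ ?_
  · simp only [Nat.even_add_one, Nat.not_even_iff_odd]
  · refine forall₂_congr fun i h => ?_
    have : Odd (r - i + 1) ↔ Even (r - i) := by rw [Nat.odd_add_one, Nat.not_odd_iff_even]
    by_cases hp : Even (r - i)
    · rw [if_pos hp, if_pos (this.2 hp)]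
    · rw [if_neg hp, if_neg fun hq => hp (this.1 hq)]

theorem altTSum_eq_altSum (L : List (ℕ × ℤˣ)) : altTSum L = altSum 0 L := by
  funext n
  simp only [altTSum, altSum, indexD_eq_altIndex]
  rfl

theorem altSSum_eq_altSum (L : List (ℕ × ℤˣ)) : altSSum L = altSum 1 L := by
  funext n
  simp only [altSSum, altSum, indexE_eq_altIndex]
  refine Finset.sum_congr rfl fun ν _ => Finset.prod_congr rfl fun i _ => ?_
  have : Odd (L.length - (i : ℕ) + 1) ↔ Even (L.length - (i : ℕ)) := by
    rw [Nat.odd_add_one, Nat.not_odd_iff_even]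
  by_cases hp : Even (L.length - (i : ℕ))
  · rw [if_pos hp, if_pos (this.2 hp)]
  · rw [if_neg hp, if_neg fun hq => hp (this.1 hq)]

/-- The recursion closes because the step from `a` to `μ 0` is strict exactly when the upper bound
for tuples of length `r` is strict: `r + 1 + e` is odd iff `r + e` is even. -/
theorem cons_mem_altIndex {e n r a : ℕ} {μ : Fin r → ℕ} :
    (Fin.cons a μ : Fin (r + 1) → ℕ) ∈ altIndex e n (r + 1) ↔
      (1 ≤ a ∧ a ≤ n ∧ (Even (r + 1 + e) → a < n)) ∧ μ ∈ altIndex e a r := by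
  rw [mem_altIndex, mem_altIndex]
  constructor
  · rintro ⟨h1, h2, h3⟩
    have ha := h1 0
    rw [Fin.cons_zero] at ha
    have h3' : ∀ (i : ℕ) (h : i + 1 < r),
        if Odd (r - i + e) then μ ⟨i + 1, h⟩ < μ ⟨i, by omega⟩
        else μ ⟨i + 1, h⟩ ≤ μ ⟨i, by omega⟩ := by
      intro i h
      have := h3 (i + 1) (by omega)
      rw [show r + 1 - (i + 1) + e = r - i + e by omega] at this
      exact this
    have hfirst : ∀ h : 0 < r, if Odd (r + 1 + e) then μ ⟨0, h⟩ < a else μ ⟨0, h⟩ ≤ a := by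
      intro h
      exact h3 0 (by omega)
    have hle : ∀ (i : ℕ) (h : i < r), μ ⟨i, h⟩ ≤ a := by
      intro i
      induction i with
      | zero =>
        intro h
        have := hfirst h
        split_ifs at this <;> omega
      | succ i ih =>
        intro h
        have h4 := h3' i h
        have h5 := ih (by omega)
        split_ifs at h4 <;> omega
    refine ⟨⟨ha.1, ha.2, fun he => (h2 (Nat.succ_pos r) he : a < n)⟩,
      fun i => ⟨?_, hle i i.2⟩, ?_, h3'⟩
    · have := (h1 i.succ).1
      rwa [Fin.cons_succ] at this
    · intro h he
      have := hfirst h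
      rwa [if_pos (by rw [show r + 1 + e = r + e + 1 by ring]; exact he.add_one)] at this
  · rintro ⟨⟨ha1, han, hae⟩, h1, h2, h3⟩
    refine ⟨?_, fun _ he => hae he, ?_⟩
    · intro i
      refine Fin.cases ?_ (fun j => ?_) i
      · exact ⟨ha1, han⟩
      · rw [Fin.cons_succ]
        exact ⟨(h1 j).1, (h1 j).2.trans han⟩
    · intro i h
      rcases i with _ | i
      · change if Odd (r + 1 - 0 + e) then μ ⟨0, by omega⟩ < a else μ ⟨0, by omega⟩ ≤ a
        split_ifs with ho
        · refine h2 (by omega) ?_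
          rw [show r + 1 - 0 + e = r + e + 1 by omega, Nat.odd_add_one,
            Nat.not_odd_iff_even] at ho
          exact ho
        · exact (h1 _).2
      · have := h3 i (by omega)
        rw [← show r + 1 - (i + 1) + e = r - i + e by omega] at this
        exact this

theorem altSum_nil (e n : ℕ) : altSum e [] n = 1 := by
  have : altIndex e n 0 = Finset.univ := by
    ext ν
    simp only [mem_altIndex, Finset.mem_univ, iff_true]
    exact ⟨fun i => i.elim0, fun h => absurd h (lt_irrefl 0), fun i h => absurd h (by omega)⟩
  change ∑ ν ∈ altIndex e n 0, ∏ i : Fin 0, _ = _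
  simp [this]

theorem altSum_cons (e : ℕ) (k : ℕ) (σ : ℤˣ) (L : List (ℕ × ℤˣ)) (n : ℕ) :
    altSum e ((k, σ) :: L) n =
      ∑ a ∈ (Finset.Icc 1 n).filter (fun a => Even (L.length + 1 + e) → a < n),
        2 * ((σ : ℤ) : ℝ) ^ a /
          (if Odd (L.length + 1 + e) then 2 * (a : ℝ) - 1 else 2 * (a : ℝ)) ^ k *
            altSum e L a := by
  simp only [altSum, Finset.mul_sum]
  rw [Finset.sum_sigma']
  refine Finset.sum_bij' (fun ν _ => ⟨ν 0, fun i : Fin L.length => ν i.succ⟩)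
    (fun s _ => (Fin.cons s.1 s.2 : Fin (L.length + 1) → ℕ)) ?_ ?_ ?_ ?_ ?_
  · intro ν hν
    have h := hν
    rw [← Fin.cons_self_tail (n := L.length) ν] at h
    have := cons_mem_altIndex.1 h
    simp only [Finset.mem_sigma, Finset.mem_filter, Finset.mem_Icc]
    exact ⟨⟨⟨this.1.1, this.1.2.1⟩, this.1.2.2⟩, this.2⟩
  · rintro ⟨a, μ⟩ h
    simp only [Finset.mem_sigma, Finset.mem_filter, Finset.mem_Icc] at h
    exact cons_mem_altIndex.2 ⟨⟨h.1.1.1, h.1.1.2, h.1.2⟩, h.2⟩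
  · intro ν _
    exact Fin.cons_self_tail (n := L.length) ν
  · rintro ⟨a, μ⟩ _
    rfl
  · intro ν _
    change ∏ i : Fin (L.length + 1), _ = _
    rw [Fin.prod_univ_succ]
    refine congrArg₂ _ ?_ ?_
    · simp
    · refine Finset.prod_congr rfl fun i _ => ?_
      have : ((k, σ) :: L).length - ((i.succ : Fin (L.length + 1)) : ℕ) + e
          = L.length - (i : ℕ) + e := by
        simp
      rw [this]
      rfl

/-! ### Sums indexed by the outermost denominator -/

/-- The sum of `c a` over the `a < b` of the other parity. -/
noncomputable def oppSum (c : ℕ → ℝ) (b : ℕ) : ℝ :=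
  ∑ a ∈ (Finset.range b).filter (fun a => Odd (a + b)), c a

/-- The summand of an alternating multiple harmonic sum, as a function of the
outermost denominator. -/
noncomputable def altCoeff (e : ℕ) : List (ℕ × ℤˣ) → ℕ → ℝ
  | [], a => if a = e then 1 else 0
  | (k, σ) :: L, b => 2 * ((σ : ℤ) : ℝ) ^ ((b + 1) / 2) / (b : ℝ) ^ k * oppSum (altCoeff e L) b

theorem altCoeff_cons (e k : ℕ) (σ : ℤˣ) (L : List (ℕ × ℤˣ)) (b : ℕ) :
    altCoeff e ((k, σ) :: L) b =
      2 * ((σ : ℤ) : ℝ) ^ ((b + 1) / 2) / (b : ℝ) ^ k * oppSum (altCoeff e L) b := by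
  simp only [altCoeff]

theorem oppSum_eq_sum_range {c : ℕ → ℝ} {ε : ℕ} (hc : ∀ a, Odd (a + ε) → c a = 0) {b : ℕ}
    (hb : Odd (b + ε)) : oppSum c b = ∑ a ∈ Finset.range b, c a := by
  refine Finset.sum_filter_of_ne fun a _ ha => ?_
  by_contra h
  refine ha (hc a ?_)
  grind

theorem oppSum_eq_zero {c : ℕ → ℝ} {ε : ℕ} (hc : ∀ a, Odd (a + ε) → c a = 0) {b : ℕ}
    (hb : Even (b + ε)) : oppSum c b = 0 := by
  refine Finset.sum_eq_zero fun a ha => hc a ?_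
  have := (Finset.mem_filter.1 ha).2
  grind

/-- The chain of denominators starts from a fictitious innermost entry `e` and changes parity at
each step. -/
theorem altCoeff_eq_zero (e : ℕ) (L : List (ℕ × ℤˣ)) (a : ℕ) (h : Odd (a + (L.length + e))) :
    altCoeff e L a = 0 := by
  induction L generalizing a with
  | nil =>
    simp only [altCoeff]
    refine if_neg ?_
    rintro rfl
    simp only [List.length_nil, zero_add] at h
    exact Nat.not_odd_iff_even.2 (Even.add_self a) h
  | cons x L ih =>
    obtain ⟨k, σ⟩ := x
    rw [altCoeff_cons, oppSum_eq_zero (ε := L.length + e) ih, mul_zero]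
    simp only [List.length_cons] at h
    grind

theorem sum_range_two_mul (f : ℕ → ℝ) (n : ℕ) :
    ∑ a ∈ Finset.range (2 * n), f a = ∑ i ∈ Finset.range n, (f (2 * i) + f (2 * i + 1)) := by
  induction n with
  | zero => simp
  | succ n ih =>
    rw [show 2 * (n + 1) = 2 * n + 1 + 1 by ring, Finset.sum_range_succ, Finset.sum_range_succ,
      Finset.sum_range_succ, ih]
    ring

/-- For `b = 2ν - 1` and for `b = 2ν` alike `(b + 1) / 2 = ν`, and the mixed `<`, `≤` conditions on
the `ν`'s say just that the denominators decrease strictly below `2n`. -/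
theorem altSum_eq_sum_range (e : ℕ) (he : e ≤ 1) (L : List (ℕ × ℤˣ)) (n : ℕ) (hn : 1 ≤ n) :
    altSum e L n = ∑ a ∈ Finset.range (2 * n), altCoeff e L a := by
  induction L generalizing n with
  | nil =>
    rw [altSum_nil]
    simp only [altCoeff, Finset.sum_ite_eq', Finset.mem_range]
    exact (if_pos (by omega)).symm
  | cons x L ih =>
    obtain ⟨k, σ⟩ := x
    have h0 := altCoeff_eq_zero e ((k, σ) :: L)
    have h1 := altCoeff_eq_zero e L
    rw [altSum_cons, sum_range_two_mul]
    by_cases ho : Odd (L.length + 1 + e)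
    · have hfil : (Finset.Icc 1 n).filter (fun a => Even (L.length + 1 + e) → a < n) =
          Finset.Icc 1 n := by
        refine Finset.filter_true_of_mem fun a _ he => ?_
        exact absurd he (Nat.not_even_iff_odd.2 ho)
      rw [hfil, Finset.range_eq_Ico, Finset.sum_Ico_eq_sum_range, Nat.sub_zero,
        show Finset.Icc 1 n = Finset.Ico 1 (n + 1) by rfl,
        Finset.sum_Ico_eq_sum_range, Nat.add_sub_cancel]
      refine Finset.sum_congr rfl fun i _ => ?_
      -- Here `ν = i + 1` has denominator `2 * i + 1`. The inner sum also includes the index `2 * i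
      -- + 1`, where the coefficient vanishes by parity.
      rw [if_pos ho, ih _ (by omega), zero_add, h0 (2 * i) (by simp only [List.length_cons]; grind),
        zero_add, altCoeff_cons, oppSum_eq_sum_range (ε := L.length + e) h1 (by grind),
        show (2 * i + 1 + 1) / 2 = 1 + i by omega, show 2 * (1 + i) = 2 * i + 1 + 1 by ring,
        Finset.sum_range_succ _ (2 * i + 1), h1 (2 * i + 1) (by grind), add_zero]
      push_cast
      ring
    -- The outermost denominator is now `2ν`, so the bound `2n` forces `ν < n`; the index 0 only
    -- contributes zero.
    · have hfil : (Finset.Icc 1 n).filter (fun a => Even (L.length + 1 + e) → a < n) =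
          Finset.Ico 1 n := by
        ext a
        simp only [Finset.mem_filter, Finset.mem_Icc, Finset.mem_Ico]
        have := Nat.not_odd_iff_even.1 ho
        grind
      rw [hfil, Finset.range_eq_Ico, Finset.sum_eq_sum_Ico_succ_bot (show 0 < n by omega)
        (fun i => altCoeff e ((k, σ) :: L) (2 * i) + altCoeff e ((k, σ) :: L) (2 * i + 1))]
      have hz : altCoeff e ((k, σ) :: L) (2 * 0) + altCoeff e ((k, σ) :: L) (2 * 0 + 1) = 0 := by
        rw [h0 (2 * 0 + 1) (by simp only [List.length_cons]; grind), altCoeff_cons]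
        simp [oppSum]
      rw [hz, zero_add]
      refine Finset.sum_congr rfl fun i hi => ?_
      rw [Finset.mem_Ico] at hi
      rw [if_neg ho, ih _ (by omega), h0 (2 * i + 1) (by simp only [List.length_cons]; grind),
        add_zero, altCoeff_cons, oppSum_eq_sum_range (ε := L.length + e) h1 (by grind),
        show (2 * i + 1) / 2 = i by omega]
      push_cast
      ring

/-! ### Calculus of `tanh` and power series in `tanh (p / 2)` -/

theorem hasDerivAt_tanh (x : ℝ) : HasDerivAt Real.tanh (1 - Real.tanh x ^ 2) x := by
  have hc := (Real.cosh_pos x).ne'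
  have h := (Real.hasDerivAt_sinh x).div (Real.hasDerivAt_cosh x) hc
  have hf : Real.tanh = Real.sinh / Real.cosh := by
    funext y
    exact Real.tanh_eq_sinh_div_cosh y
  rw [hf]
  refine h.congr_deriv ?_
  rw [Pi.div_apply]
  field_simp

theorem continuous_tanh : Continuous Real.tanh :=
  continuous_iff_continuousAt.2 fun x => (hasDerivAt_tanh x).continuousAt

theorem tanh_nonneg {x : ℝ} (hx : 0 ≤ x) : 0 ≤ Real.tanh x := by
  rw [Real.tanh_eq_sinh_div_cosh]
  exact div_nonneg (Real.sinh_nonneg_iff.2 hx) (Real.cosh_pos x).le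

theorem tanh_pos {x : ℝ} (hx : 0 < x) : 0 < Real.tanh x := by
  rw [Real.tanh_eq_sinh_div_cosh]
  exact div_pos (Real.sinh_pos_iff.2 hx) (Real.cosh_pos x)

theorem monotone_tanh : Monotone Real.tanh :=
  monotone_of_deriv_nonneg (fun x => (hasDerivAt_tanh x).differentiableAt) fun x => by
    rw [(hasDerivAt_tanh x).deriv]
    linarith [Real.tanh_sq_lt_one x]

theorem tendsto_tanh_atTop : Tendsto Real.tanh atTop (𝓝 1) := by
  have h : Real.tanh = fun x => 1 - 2 / (Real.exp (2 * x) + 1) := by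
    funext x
    rw [Real.tanh_eq, Real.exp_neg, two_mul, Real.exp_add]
    have := Real.exp_pos x
    field_simp
    ring
  rw [h]
  have h2 : Tendsto (fun x : ℝ => Real.exp (2 * x) + 1) atTop atTop :=
    tendsto_atTop_add_const_right _ _
      (Real.tendsto_exp_atTop.comp (tendsto_id.const_mul_atTop (by norm_num)))
  simpa using (h2.const_div_atTop 2).const_sub 1

theorem hasDerivAt_tanh_half (p : ℝ) :
    HasDerivAt (fun p => Real.tanh (p / 2)) ((1 - Real.tanh (p / 2) ^ 2) / 2) p := by
  have := (hasDerivAt_tanh (p / 2)).comp p ((hasDerivAt_id p).div_const 2)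
  exact this.congr_deriv (by simp; ring)

theorem hasDerivAt_tanh_half_pow (b : ℕ) (p : ℝ) :
    HasDerivAt (fun p => Real.tanh (p / 2) ^ (b + 1) / ((b : ℝ) + 1))
      (Real.tanh (p / 2) ^ b * ((1 - Real.tanh (p / 2) ^ 2) / 2)) p := by
  have := ((hasDerivAt_tanh_half p).pow (b + 1)).div_const ((b : ℝ) + 1)
  refine this.congr_deriv ?_
  have : (b : ℝ) + 1 ≠ 0 := by positivity
  push_cast
  field_simp

theorem continuous_tanh_half : Continuous fun p : ℝ => Real.tanh (p / 2) :=
  continuous_tanh.comp (continuous_id.div_const 2)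

theorem tanh_half_mem {p : ℝ} (hp : 0 ≤ p) : 0 ≤ Real.tanh (p / 2) ∧ Real.tanh (p / 2) < 1 :=
  ⟨tanh_nonneg (by linarith), Real.tanh_lt_one _⟩

/-- Termwise integration of a power series in `tanh (p / 2)`. -/
theorem hasSum_integral_tanh_half {d : ℕ → ℝ} {f : ℝ → ℝ}
    (h : ∀ p, 0 ≤ p → HasSum
      (fun b => d b * (Real.tanh (p / 2) ^ b * ((1 - Real.tanh (p / 2) ^ 2) / 2))) (f p))
    {p : ℝ} (hp : 0 ≤ p) :
    HasSum (fun b => d b / ((b : ℝ) + 1) * Real.tanh (p / 2) ^ (b + 1)) (∫ q in 0..p, f q) := by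
  have hint : ∀ b : ℕ, ∫ q in (0 : ℝ)..p,
      d b * (Real.tanh (q / 2) ^ b * ((1 - Real.tanh (q / 2) ^ 2) / 2)) =
        d b / ((b : ℝ) + 1) * Real.tanh (p / 2) ^ (b + 1) := by
    intro b
    rw [intervalIntegral.integral_const_mul,
      intervalIntegral.integral_eq_sub_of_hasDerivAt (fun q _ => hasDerivAt_tanh_half_pow b q)]
    · simp
      ring
    · apply Continuous.intervalIntegrable
      have := continuous_tanh_half
      fun_prop
  simp_rw [← hint]
  have hτ := tanh_half_mem hp
  -- Convergence at the endpoint `p` is absolute; after removal of the positive factor independent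
  -- of `b`, it dominates the series on all of `[0, p]` by monotonicity of `tanh`.
  have hsum : Summable fun b => |d b| * Real.tanh (p / 2) ^ b := by
    have h1 := (h p hp).summable.abs
    have hpos : 0 < (1 - Real.tanh (p / 2) ^ 2) / 2 := by
      linarith [Real.tanh_sq_lt_one (p / 2)]
    refine (h1.mul_right ((1 - Real.tanh (p / 2) ^ 2) / 2)⁻¹).congr fun b => ?_
    rw [abs_mul, abs_mul, abs_of_pos hpos, abs_of_nonneg (pow_nonneg hτ.1 b),
      ← mul_assoc, mul_inv_cancel_right₀ hpos.ne']
  refine intervalIntegral.hasSum_integral_of_dominated_convergence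
    (fun b _ => |d b| * Real.tanh (p / 2) ^ b) ?_ ?_ ?_ ?_ ?_
  · intro b
    apply Continuous.aestronglyMeasurable
    have := continuous_tanh_half
    fun_prop
  · intro b
    refine ae_of_all _ fun q hq => ?_
    rw [uIoc_of_le hp] at hq
    have hq1 := tanh_half_mem hq.1.le
    have hmono : Real.tanh (q / 2) ≤ Real.tanh (p / 2) := monotone_tanh (by linarith [hq.2])
    have hsq := Real.tanh_sq_lt_one (q / 2)
    rw [Real.norm_eq_abs, abs_mul, abs_mul, abs_of_nonneg (pow_nonneg hq1.1 b),
      abs_of_pos (by linarith : 0 < (1 - Real.tanh (q / 2) ^ 2) / 2)]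
    refine mul_le_mul_of_nonneg_left ?_ (abs_nonneg _)
    refine (mul_le_of_le_one_right (pow_nonneg hq1.1 b) ?_).trans (pow_le_pow_left₀ hq1.1 hmono b)
    nlinarith [sq_nonneg (Real.tanh (q / 2))]
  · exact ae_of_all _ fun _ _ => hsum
  · exact intervalIntegrable_const
  · refine ae_of_all _ fun q hq => ?_
    rw [uIoc_of_le hp] at hq
    exact h q hq.1.le

theorem hasSum_even_pow {y : ℝ} (h0 : 0 ≤ y) (h1 : y < 1) :
    HasSum (fun i => if Even i then y ^ i else 0) (1 - y ^ 2)⁻¹ := by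
  have hinj : Function.Injective fun i : ℕ => 2 * i := fun a b h => by simpa using h
  rw [← hinj.hasSum_iff]
  · have := hasSum_geometric_of_lt_one (sq_nonneg y) (by nlinarith : y ^ 2 < 1)
    refine this.congr_fun fun i => ?_
    simp [pow_mul]
  · intro i hi
    refine if_neg fun he => hi ?_
    obtain ⟨j, rfl⟩ := he
    exact ⟨j, by ring⟩

/-- Cauchy product with `1 / (1 - y²)`, whose coefficients select the even differences `b - a`. -/
theorem hasSum_oppSum {c : ℕ → ℝ} {y s : ℝ} (h0 : 0 ≤ y) (h1 : y < 1)
    (h : HasSum (fun a => c a * y ^ a) s) :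
    HasSum (fun b => oppSum c (b + 1) * y ^ b) (s * (1 - y ^ 2)⁻¹) := by
  have he := hasSum_even_pow h0 h1
  have := hasSum_sum_range_mul_of_summable_norm h.summable.norm he.summable.norm
  rw [h.tsum_eq, he.tsum_eq] at this
  refine this.congr_fun fun b => ?_
  rw [oppSum, Finset.sum_mul, Finset.sum_filter]
  refine Finset.sum_congr rfl fun a ha => ?_
  rw [Finset.mem_range] at ha
  by_cases hev : Even (b - a)
  · rw [if_pos hev, if_pos (by grind), mul_assoc, ← pow_add, Nat.add_sub_cancel' (by omega)]
  · rw [if_neg hev, if_neg (by grind), mul_zero]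

/-! ### Generating functions as iterated integrals -/

/-- The kernels `1 / cosh q` (`e = 0`) and `tanh (q / 2) / cosh q` (`e = 1`). -/
noncomputable def altKernel (e : ℕ) (q : ℝ) : ℝ := Real.tanh (q / 2) ^ e / Real.cosh q

theorem continuous_altKernel (e : ℕ) : Continuous (altKernel e) :=
  (continuous_tanh_half.pow e).div Real.continuous_cosh fun q => (Real.cosh_pos q).ne'

theorem cosh_eq_tanh_half (q : ℝ) :
    Real.cosh q = (1 + Real.tanh (q / 2) ^ 2) / (1 - Real.tanh (q / 2) ^ 2) := by
  have h1 : 1 - Real.tanh (q / 2) ^ 2 = 1 / Real.cosh (q / 2) ^ 2 := by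
    have := Real.cosh_sq (q / 2)
    have hc := (Real.cosh_pos (q / 2)).ne'
    rw [Real.tanh_eq_sinh_div_cosh]
    field_simp
    linarith
  have hc := (Real.cosh_pos (q / 2)).ne'
  rw [h1, Real.tanh_eq_sinh_div_cosh]
  conv_lhs => rw [show q = 2 * (q / 2) by ring, Real.cosh_two_mul]
  field_simp

theorem sinh_eq_tanh_half (q : ℝ) :
    Real.sinh q = 2 * Real.tanh (q / 2) / (1 - Real.tanh (q / 2) ^ 2) := by
  have h1 : 1 - Real.tanh (q / 2) ^ 2 = 1 / Real.cosh (q / 2) ^ 2 := by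
    have := Real.cosh_sq (q / 2)
    have hc := (Real.cosh_pos (q / 2)).ne'
    rw [Real.tanh_eq_sinh_div_cosh]
    field_simp
    linarith
  have hc := (Real.cosh_pos (q / 2)).ne'
  rw [h1, Real.tanh_eq_sinh_div_cosh]
  conv_lhs => rw [show q = 2 * (q / 2) by ring, Real.sinh_two_mul]
  field_simp

/-- The integral from `0`, as an operator on functions. -/
noncomputable def integralFromZero (f : ℝ → ℝ) (p : ℝ) : ℝ := ∫ q in 0..p, f q

/-- The iterated integrals of `altKernel e`. -/
noncomputable def iterKernel (e j : ℕ) : ℝ → ℝ := integralFromZero^[j + 1] (altKernel e)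

theorem iterKernel_zero (e : ℕ) (p : ℝ) :
    iterKernel e 0 p = ∫ q in 0..p, altKernel e q := rfl

theorem iterKernel_succ (e j : ℕ) (p : ℝ) :
    iterKernel e (j + 1) p = ∫ q in 0..p, iterKernel e j q := by
  rw [iterKernel, Function.iterate_succ_apply']
  rfl

/-- The component list `({1}_j, \bar 1)`. -/
def onesBar (j : ℕ) : List (ℕ × ℤˣ) := List.replicate j (1, 1) ++ [(1, -1)]

theorem onesBar_succ (j : ℕ) : onesBar (j + 1) = (1, 1) :: onesBar j := rfl

theorem altCoeff_cons_zero (e k : ℕ) (σ : ℤˣ) (L : List (ℕ × ℤˣ)) :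
    altCoeff e ((k, σ) :: L) 0 = 0 := by
  simp [altCoeff_cons, oppSum]

/-- A geometric series in `-y²`: only the exponents `b = 2 * i + e` survive. -/
theorem hasSum_base {e : ℕ} (he : e ≤ 1) {y : ℝ} (h0 : 0 ≤ y) (h1 : y < 1) :
    HasSum (fun b => 2 * (-1) ^ ((b + 1 + 1) / 2) * oppSum (altCoeff e []) (b + 1) * y ^ b)
      (-2 * y ^ e / (1 + y ^ 2)) := by
  have hopp : ∀ b, oppSum (altCoeff e []) (b + 1) =
      if e < b + 1 ∧ Odd (e + (b + 1)) then 1 else 0 := by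
    intro b
    simp only [oppSum, altCoeff, Finset.sum_ite_eq', Finset.mem_filter, Finset.mem_range]
  have hinj : Function.Injective fun i : ℕ => 2 * i + e := fun a b h => by simpa using h
  rw [← hinj.hasSum_iff]
  · have := (hasSum_geometric_of_abs_lt_one (r := -y ^ 2)
      (by rw [abs_neg, abs_of_nonneg (sq_nonneg y)]; nlinarith)).mul_left (-2 * y ^ e)
    rw [sub_neg_eq_add, ← div_eq_mul_inv] at this
    refine this.congr_fun fun i => ?_
    simp only [Function.comp_apply, hopp]
    rw [if_pos (by grind), show (2 * i + e + 1 + 1) / 2 = i + 1 by omega, pow_add y, pow_mul y,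
      neg_pow (y ^ 2), pow_succ]
    ring
  · intro b hb
    rw [hopp, if_neg, mul_zero, zero_mul]
    rintro ⟨h2, h3⟩
    refine hb ⟨(b - e) / 2, ?_⟩
    change 2 * ((b - e) / 2) + e = b
    grind

/-- Each new component 1 multiplies the generating function by `2 / (1 - y²)` and integrates in `y`.
With `y = tanh (p / 2)` the Jacobian `(1 - y²) / 2` cancels that factor, leaving an integral in `p`.
-/
theorem hasSum_iterKernel {e : ℕ} (he : e ≤ 1) (j : ℕ) {p : ℝ} (hp : 0 ≤ p) :
    HasSum (fun a => altCoeff e (onesBar j) a * Real.tanh (p / 2) ^ a) (-iterKernel e j p) := by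
  induction j generalizing p with
  | zero =>
    have h : ∀ p : ℝ, 0 ≤ p → HasSum (fun b : ℕ =>
        (2 * (-1) ^ ((b + 1 + 1) / 2) * oppSum (altCoeff e []) (b + 1)) *
          (Real.tanh (p / 2) ^ b * ((1 - Real.tanh (p / 2) ^ 2) / 2))) (-altKernel e p) := by
      intro p hp
      have hτ := tanh_half_mem hp
      have := (hasSum_base he hτ.1 hτ.2).mul_right ((1 - Real.tanh (p / 2) ^ 2) / 2)
      have hval : -altKernel e p = -2 * Real.tanh (p / 2) ^ e / (1 + Real.tanh (p / 2) ^ 2) *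
          ((1 - Real.tanh (p / 2) ^ 2) / 2) := by
        rw [altKernel, cosh_eq_tanh_half]
        have := Real.tanh_sq_lt_one (p / 2)
        have : 1 - Real.tanh (p / 2) ^ 2 ≠ 0 := by linarith
        field_simp
      rw [hval]
      exact this.congr_fun fun b => by ring
    have := hasSum_integral_tanh_half h hp
    rw [intervalIntegral.integral_neg, ← iterKernel_zero] at this
    have h0 : altCoeff e (onesBar 0) 0 * Real.tanh (p / 2) ^ 0 = 0 := by
      change altCoeff e ((1, -1) :: []) 0 * _ = 0
      rw [altCoeff_cons_zero, zero_mul]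
    rw [← hasSum_nat_add_iff' 1, Finset.sum_range_one, h0, sub_zero]
    refine this.congr_fun fun b => ?_
    change altCoeff e ((1, -1) :: []) (b + 1) * _ = _
    rw [altCoeff_cons]
    push_cast
    ring
  | succ j ih =>
    have h : ∀ p : ℝ, 0 ≤ p → HasSum (fun b : ℕ =>
        (2 * oppSum (altCoeff e (onesBar j)) (b + 1)) *
          (Real.tanh (p / 2) ^ b * ((1 - Real.tanh (p / 2) ^ 2) / 2))) (-iterKernel e j p) := by
      intro p hp
      have hτ := tanh_half_mem hp
      have := (hasSum_oppSum hτ.1 hτ.2 (ih hp)).mul_right (1 - Real.tanh (p / 2) ^ 2)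
      have hsq := Real.tanh_sq_lt_one (p / 2)
      rw [inv_mul_cancel_right₀ (by linarith)] at this
      exact this.congr_fun fun b => by ring
    have := hasSum_integral_tanh_half h hp
    rw [intervalIntegral.integral_neg, ← iterKernel_succ] at this
    have h0 : altCoeff e (onesBar (j + 1)) 0 * Real.tanh (p / 2) ^ 0 = 0 := by
      rw [onesBar_succ, altCoeff_cons_zero, zero_mul]
    rw [← hasSum_nat_add_iff' 1, Finset.sum_range_one, h0, sub_zero]
    refine this.congr_fun fun b => ?_
    rw [onesBar_succ, altCoeff_cons]
    push_cast
    rw [one_pow]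
    ring

/-! ### Sign of the coefficients and the integral representation -/

/-- The upper bound is what makes the induction for the lower bound work. -/
theorem alternating_sum_mem (f : ℕ → ℝ) (hf : Antitone f) (h0 : ∀ i, 0 ≤ f i) (n : ℕ) :
    0 ≤ ∑ i ∈ Finset.range n, (-1) ^ i * f i ∧ ∑ i ∈ Finset.range n, (-1) ^ i * f i ≤ f 0 := by
  induction n generalizing f with
  | zero => simpa using h0 0
  | succ n ih =>
    have := ih (fun i => f (i + 1)) (fun a b hab => hf (by omega)) fun i => h0 _
    have h1 := hf (Nat.zero_le 1)
    rw [Finset.sum_range_succ']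
    simp only [pow_succ, mul_neg, mul_one, neg_mul, Finset.sum_neg_distrib, pow_zero, one_mul]
    constructor <;> linarith [this.1, this.2]

theorem oppSum_onesBar_zero_nonpos {e : ℕ} (he : e ≤ 1) (b : ℕ) :
    oppSum (altCoeff e (onesBar 0)) b ≤ 0 := by
  have hz := altCoeff_eq_zero e (onesBar 0)
  have hlen : (onesBar 0).length = 1 := rfl
  rw [hlen] at hz
  rcases Nat.even_or_odd (b + (1 + e)) with hb | hb
  · rw [oppSum_eq_zero hz hb]
  · rw [oppSum_eq_sum_range hz hb]
    -- On the supporting parity class the coefficients alternate in sign, with decreasing absolute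
    -- value and first term negative.
    have key : ∀ i, altCoeff e (onesBar 0) (2 * i + 1 + e) =
        -((-1) ^ i * (2 / (2 * (i : ℝ) + 1 + e))) := by
      intro i
      change altCoeff e ((1, -1) :: []) _ = _
      rw [altCoeff_cons, oppSum_eq_sum_range (ε := e)
        (fun a ha => altCoeff_eq_zero e [] a (by simpa using ha))
        (by grind)]
      simp only [altCoeff, Finset.sum_ite_eq', Finset.mem_range]
      rw [if_pos (by omega), show (2 * i + 1 + e + 1) / 2 = i + 1 by omega]
      push_cast
      rw [pow_succ]
      ring
    have hsum : ∑ a ∈ Finset.range b, altCoeff e (onesBar 0) a =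
        ∑ i ∈ Finset.range (b / 2), altCoeff e (onesBar 0) (2 * i + 1 + e) := by
      interval_cases e
      · obtain ⟨n, rfl⟩ : ∃ n, b = 2 * n := ⟨b / 2, by grind⟩
        rw [sum_range_two_mul, Nat.mul_div_cancel_left _ two_pos]
        refine Finset.sum_congr rfl fun i _ => ?_
        rw [hz (2 * i) (by grind), zero_add, add_zero]
      · obtain ⟨n, rfl⟩ : ∃ n, b = 2 * n + 1 := ⟨b / 2, by grind⟩
        rw [Finset.sum_range_succ', sum_range_two_mul, show (2 * n + 1) / 2 = n by omega,
          show altCoeff 1 (onesBar 0) 0 = 0 from altCoeff_cons_zero 1 1 (-1) [], add_zero]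
        refine Finset.sum_congr rfl fun i _ => ?_
        rw [hz (2 * i + 1) (by grind), zero_add]
    rw [hsum, Finset.sum_congr rfl fun i _ => key i, Finset.sum_neg_distrib, neg_nonpos]
    refine (alternating_sum_mem (fun i => 2 / (2 * (i : ℝ) + 1 + e)) ?_ ?_ _).1
    · intro i j hij
      have : (i : ℝ) ≤ j := by exact_mod_cast hij
      simp only
      gcongr
    · intro i
      positivity

/-- Constant sign is what permits termwise integration up to `p = ∞`, that is `y = 1`. It needs at
least one unbarred 1, since the coefficients of `\bar 1` alone alternate. -/
theorem altCoeff_onesBar_nonpos {e : ℕ} (he : e ≤ 1) (j b : ℕ) :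
    altCoeff e (onesBar (j + 1)) b ≤ 0 := by
  induction j generalizing b with
  | zero =>
    rw [onesBar_succ, altCoeff_cons]
    refine mul_nonpos_of_nonneg_of_nonpos ?_ (oppSum_onesBar_zero_nonpos he b)
    simp only [Units.val_one, Int.cast_one, one_pow, mul_one, pow_one]
    positivity
  | succ j ih =>
    rw [onesBar_succ, altCoeff_cons]
    refine mul_nonpos_of_nonneg_of_nonpos ?_ (Finset.sum_nonpos fun a _ => ih a)
    simp only [Units.val_one, Int.cast_one, one_pow, mul_one, pow_one]
    positivity

theorem integral_Ioi_tanh_half_pow (b : ℕ) :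
    IntegrableOn (fun p => Real.tanh (p / 2) ^ b * ((1 - Real.tanh (p / 2) ^ 2) / 2)) (Ioi 0) ∧
    ∫ p in Ioi (0 : ℝ), Real.tanh (p / 2) ^ b * ((1 - Real.tanh (p / 2) ^ 2) / 2) =
      1 / ((b : ℝ) + 1) := by
  have hpos : ∀ p ∈ Ioi (0 : ℝ), 0 ≤ Real.tanh (p / 2) ^ b * ((1 - Real.tanh (p / 2) ^ 2) / 2) := by
    intro p hp
    have := Real.tanh_sq_lt_one (p / 2)
    exact mul_nonneg (pow_nonneg (tanh_half_mem (le_of_lt hp)).1 b) (by linarith)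
  have hlim : Tendsto (fun p : ℝ => Real.tanh (p / 2) ^ (b + 1) / ((b : ℝ) + 1)) atTop
      (𝓝 (1 / ((b : ℝ) + 1))) := by
    have h1 : Tendsto (fun p : ℝ => Real.tanh (p / 2)) atTop (𝓝 1) :=
      tendsto_tanh_atTop.comp (tendsto_id.atTop_div_const two_pos)
    simpa using (h1.pow (b + 1)).div_const ((b : ℝ) + 1)
  refine ⟨integrableOn_Ioi_deriv_of_nonneg' (fun p _ => hasDerivAt_tanh_half_pow b p) hpos hlim, ?_⟩
  rw [integral_Ioi_of_hasDerivAt_of_nonneg' (fun p _ => hasDerivAt_tanh_half_pow b p) hpos hlim]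
  simp

/-- Raising the outer exponent from 1 to 2 divides the coefficient by `b`, which is integration
against `dy / y = dp / sinh p`. -/
theorem hasSum_altCoeff_two {e : ℕ} (he : e ≤ 1) (j : ℕ)
    (hint : IntegrableOn (fun p => iterKernel e (j + 1) p / Real.sinh p) (Ioi 0)) :
    HasSum (altCoeff e ((2, 1) :: onesBar j))
      (-∫ p in Ioi (0 : ℝ), iterKernel e (j + 1) p / Real.sinh p) := by
  set c := altCoeff e (onesBar (j + 1)) with hc
  have hc0 : c 0 = 0 := altCoeff_cons_zero e 1 1 (onesBar j)
  set F : ℕ → ℝ → ℝ := fun b p =>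
    -c (b + 1) * (Real.tanh (p / 2) ^ b * ((1 - Real.tanh (p / 2) ^ 2) / 2)) with hF
  have hFi : ∀ b, IntegrableOn (F b) (Ioi 0) := fun b =>
    (integral_Ioi_tanh_half_pow b).1.const_mul _
  have hFint : ∀ b, ∫ p in Ioi (0 : ℝ), F b p = -c (b + 1) / ((b : ℝ) + 1) := by
    intro b
    rw [integral_const_mul, (integral_Ioi_tanh_half_pow b).2]
    ring
  have hFpos : ∀ b p, p ∈ Ioi (0 : ℝ) → 0 ≤ F b p := by
    intro b p hp
    have := Real.tanh_sq_lt_one (p / 2)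
    exact mul_nonneg (neg_nonneg.2 (altCoeff_onesBar_nonpos he j (b + 1)))
      (mul_nonneg (pow_nonneg (tanh_half_mem (le_of_lt hp)).1 b) (by linarith))
  have hFsum : ∀ p ∈ Ioi (0 : ℝ), HasSum (fun b => F b p)
      (iterKernel e (j + 1) p / Real.sinh p) := by
    intro p hp
    have h1 := hasSum_iterKernel he (j + 1) (le_of_lt hp)
    rw [← hasSum_nat_add_iff' 1, Finset.sum_range_one, ← hc, hc0, zero_mul, sub_zero] at h1
    have h2 := h1.neg.mul_right (Real.sinh p)⁻¹
    rw [neg_neg, ← div_eq_mul_inv] at h2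
    refine h2.congr_fun fun b => ?_
    have ht : Real.tanh (p / 2) ≠ 0 := (tanh_pos (half_pos hp)).ne'
    have hs : 1 - Real.tanh (p / 2) ^ 2 ≠ 0 := by
      have := Real.tanh_sq_lt_one (p / 2)
      linarith
    rw [hF, sinh_eq_tanh_half]
    field_simp
    ring
  -- The terms are nonnegative, so the integrals of the partial sums are bounded by the integral of
  -- the full sum, finite by `hint`.
  have hsummable : Summable fun b => ∫ p in Ioi (0 : ℝ), F b p := by
    refine summable_of_sum_range_le (c := ∫ p in Ioi (0 : ℝ), iterKernel e (j + 1) p / Real.sinh p)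
      (fun b => setIntegral_nonneg measurableSet_Ioi (hFpos b)) fun n => ?_
    rw [← integral_finsetSum _ fun b _ => hFi b]
    refine setIntegral_mono_on (integrable_finsetSum _ fun b _ => hFi b) hint measurableSet_Ioi ?_
    intro p hp
    exact sum_le_hasSum _ (fun b _ => hFpos b p hp) (hFsum p hp)
  have h3 := hasSum_integral_of_summable_integral_norm (μ := volume.restrict (Ioi (0 : ℝ)))
    (F := F) hFi ?_
  · have h4 : ∫ p in Ioi (0 : ℝ), ∑' b, F b p =
        ∫ p in Ioi (0 : ℝ), iterKernel e (j + 1) p / Real.sinh p :=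
      setIntegral_congr_fun measurableSet_Ioi fun p hp => (hFsum p hp).tsum_eq
    rw [h4] at h3
    rw [← hasSum_nat_add_iff' 1, Finset.sum_range_one, altCoeff_cons_zero, sub_zero]
    refine h3.neg.congr_fun fun b => ?_
    rw [hFint, hc, onesBar_succ, altCoeff_cons, altCoeff_cons]
    push_cast
    have : (b : ℝ) + 1 ≠ 0 := by positivity
    field_simp
  · refine hsummable.congr fun b => ?_
    refine setIntegral_congr_fun measurableSet_Ioi fun p hp => ?_
    exact (Real.norm_of_nonneg (hFpos b p hp)).symm

/-! ### Cauchy's formula for the iterated integrals -/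

/-- Cauchy's formula for repeated integration. -/
theorem iterate_integralFromZero (g : ℝ → ℝ) (hg : Continuous g) (j : ℕ) (p : ℝ) :
    integralFromZero^[j + 1] g p = (∫ q in 0..p, (p - q) ^ j * g q) / (j.factorial : ℝ) := by
  induction j generalizing g with
  | zero => simp [integralFromZero]
  | succ j ih =>
    have hd : ∀ q, HasDerivAt (integralFromZero g) (g q) q := fun q =>
      intervalIntegral.integral_hasDerivAt_right (hg.intervalIntegrable _ _)
        (hg.stronglyMeasurableAtFilter _ _) hg.continuousAt
    have hc : Continuous (integralFromZero g) :=
      continuous_iff_continuousAt.2 fun q => (hd q).continuousAt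
    have hu : ∀ q : ℝ, HasDerivAt (fun q => (p - q) ^ (j + 1))
        (-(((j : ℝ) + 1) * (p - q) ^ j)) q := by
      intro q
      have := ((hasDerivAt_id q).const_sub p).pow (j + 1)
      exact this.congr_deriv (by simp)
    -- Both boundary terms vanish: the power at `q = p`, the primitive at `q = 0`.
    have hparts := intervalIntegral.integral_mul_deriv_eq_deriv_mul (a := 0) (b := p)
      (fun q _ => hu q) (fun q _ => hd q)
      (Continuous.intervalIntegrable (by fun_prop) _ _) (hg.intervalIntegrable _ _)
    rw [Function.iterate_succ_apply, ih _ hc, hparts, sub_self,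
      show integralFromZero g 0 = 0 from intervalIntegral.integral_same, Nat.factorial_succ]
    simp only [neg_mul, mul_assoc]
    rw [intervalIntegral.integral_neg, intervalIntegral.integral_const_mul]
    have h1 : (j.factorial : ℝ) ≠ 0 := by positivity
    have h2 : (j : ℝ) + 1 ≠ 0 := by positivity
    push_cast
    field_simp
    simp

theorem iterKernel_eq (e j : ℕ) (p : ℝ) :
    iterKernel e j p = (∫ q in 0..p, (p - q) ^ j * altKernel e q) / (j.factorial : ℝ) :=
  iterate_integralFromZero _ (continuous_altKernel e) j p

/-! ### Moments of `1 / sinh` and `1 / cosh` -/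

theorem integral_pow_mul_exp (j : ℕ) {r : ℝ} (hr : 0 < r) :
    IntegrableOn (fun x : ℝ => x ^ j * Real.exp (-(r * x))) (Ioi 0) ∧
    ∫ x in Ioi (0 : ℝ), x ^ j * Real.exp (-(r * x)) = (j.factorial : ℝ) / r ^ (j + 1) := by
  have h : ∫ x in Ioi (0 : ℝ), x ^ j * Real.exp (-(r * x)) = (j.factorial : ℝ) / r ^ (j + 1) := by
    have := Real.integral_rpow_mul_exp_neg_mul_Ioi (a := (j : ℝ) + 1) (by positivity) hr
    rw [add_sub_cancel_right, Real.Gamma_nat_eq_factorial] at this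
    have h2 : (1 / r) ^ ((j : ℝ) + 1) = (1 / r) ^ (j + 1) := by
      exact_mod_cast Real.rpow_natCast (1 / r) (j + 1)
    rw [h2] at this
    simp only [Real.rpow_natCast] at this
    rw [this, one_div, inv_pow]
    ring
  -- The integral of a non-integrable function is 0 by convention, so a nonzero value proves
  -- integrability.
  refine ⟨Integrable.of_integral_ne_zero ?_, h⟩
  rw [h]
  positivity

theorem summable_odd_pow {j : ℕ} (hj : 1 ≤ j) :
    Summable fun n : ℕ => 1 / (2 * (n : ℝ) + 1) ^ (j + 1) := by
  have h : Summable fun n : ℕ => 1 / (n : ℝ) ^ (j + 1) :=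
    Real.summable_one_div_nat_pow.2 (by omega)
  have hinj : Function.Injective fun i : ℕ => 2 * i + 1 := fun a b h => by simpa using h
  refine (h.comp_injective hinj).congr fun n => ?_
  simp

/-- Serves both hyperbolic functions: `c n = 1` for `1 / sinh`, `c n = (-1) ^ n` for `1 / cosh`. -/
theorem hasSum_integral_pow_mul {c : ℕ → ℝ} (hc : ∀ n, |c n| ≤ 1) {f : ℝ → ℝ}
    (hf : ∀ x, 0 < x → HasSum (fun n : ℕ => c n * Real.exp (-((2 * (n : ℝ) + 1) * x))) (f x))
    {j : ℕ} (hj : 1 ≤ j) :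
    HasSum (fun n : ℕ => (j.factorial : ℝ) * (c n / (2 * (n : ℝ) + 1) ^ (j + 1)))
      (∫ x in Ioi (0 : ℝ), x ^ j * f x) := by
  have hr : ∀ n : ℕ, (0 : ℝ) < 2 * (n : ℝ) + 1 := fun n => by positivity
  have h := hasSum_integral_of_summable_integral_norm (μ := volume.restrict (Ioi (0 : ℝ)))
    (F := fun (n : ℕ) (x : ℝ) => c n * (x ^ j * Real.exp (-((2 * (n : ℝ) + 1) * x))))
    (fun n => (integral_pow_mul_exp j (hr n)).1.const_mul _) ?_
  · have h2 : ∫ x in Ioi (0 : ℝ), ∑' n : ℕ, c n * (x ^ j * Real.exp (-((2 * (n : ℝ) + 1) * x))) =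
        ∫ x in Ioi (0 : ℝ), x ^ j * f x := by
      refine setIntegral_congr_fun measurableSet_Ioi fun x hx => ?_
      refine HasSum.tsum_eq ?_
      exact ((hf x hx).mul_left (x ^ j)).congr_fun fun n => by ring
    rw [h2] at h
    refine h.congr_fun fun n => ?_
    rw [integral_const_mul, (integral_pow_mul_exp j (hr n)).2]
    ring
  · refine Summable.of_nonneg_of_le (fun n => integral_nonneg fun x => norm_nonneg _) (fun n => ?_)
      ((summable_odd_pow hj).mul_left (j.factorial : ℝ))
    rw [mul_one_div, ← (integral_pow_mul_exp j (hr n)).2]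
    refine setIntegral_mono_on ((integral_pow_mul_exp j (hr n)).1.const_mul _).norm
      (integral_pow_mul_exp j (hr n)).1 measurableSet_Ioi fun x hx => ?_
    rw [norm_mul, Real.norm_eq_abs, Real.norm_eq_abs,
      abs_of_nonneg (mul_nonneg (pow_nonneg (le_of_lt hx) j) (Real.exp_pos _).le)]
    exact mul_le_of_le_one_left (mul_nonneg (pow_nonneg (le_of_lt hx) j) (Real.exp_pos _).le) (hc n)

theorem hasSum_inv_sinh {x : ℝ} (hx : 0 < x) :
    HasSum (fun n : ℕ => 1 * Real.exp (-((2 * (n : ℝ) + 1) * x))) (1 / (2 * Real.sinh x)) := by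
  have h1 : Real.exp (-x) ^ 2 < 1 := by
    rw [← Real.exp_nat_mul, Real.exp_lt_one_iff]
    push_cast
    linarith
  have h := (hasSum_geometric_of_lt_one (sq_nonneg (Real.exp (-x))) h1).mul_left (Real.exp (-x))
  have hv : 1 / (2 * Real.sinh x) = Real.exp (-x) * (1 - Real.exp (-x) ^ 2)⁻¹ := by
    have h2 : 1 - Real.exp (-x) ^ 2 ≠ 0 := by linarith
    have h3 : 2 * Real.sinh x = Real.exp x - Real.exp (-x) := by rw [Real.sinh_eq]; ring
    have h4 : Real.exp x * Real.exp (-x) = 1 := by rw [← Real.exp_add]; simp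
    have h5 : Real.exp x - Real.exp (-x) ≠ 0 := by
      rw [← h3]
      have := Real.sinh_pos_iff.2 hx
      positivity
    rw [h3]
    field_simp
    linear_combination -h4
  rw [hv]
  refine h.congr_fun fun n => ?_
  rw [one_mul, ← Real.exp_nat_mul, ← Real.exp_nat_mul, ← Real.exp_add]
  congr 1
  push_cast
  ring

theorem hasSum_inv_cosh {x : ℝ} (hx : 0 < x) :
    HasSum (fun n : ℕ => (-1) ^ n * Real.exp (-((2 * (n : ℝ) + 1) * x)))
      (1 / (2 * Real.cosh x)) := by
  have h1 : Real.exp (-x) ^ 2 < 1 := by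
    rw [← Real.exp_nat_mul, Real.exp_lt_one_iff]
    push_cast
    linarith
  have h := (hasSum_geometric_of_abs_lt_one (r := -Real.exp (-x) ^ 2)
    (by rwa [abs_neg, abs_of_nonneg (sq_nonneg _)])).mul_left (Real.exp (-x))
  have hv : 1 / (2 * Real.cosh x) = Real.exp (-x) * (1 - -Real.exp (-x) ^ 2)⁻¹ := by
    have h2 : 1 - -Real.exp (-x) ^ 2 ≠ 0 := by
      have := sq_nonneg (Real.exp (-x))
      linarith
    have h3 : 2 * Real.cosh x = Real.exp x + Real.exp (-x) := by rw [Real.cosh_eq]; ring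
    have h4 : Real.exp x * Real.exp (-x) = 1 := by rw [← Real.exp_add]; simp
    have h5 : Real.exp x + Real.exp (-x) ≠ 0 := by positivity
    rw [h3]
    field_simp
    linear_combination -h4
  rw [hv]
  refine h.congr_fun fun n => ?_
  rw [neg_pow (Real.exp (-x) ^ 2), ← Real.exp_nat_mul, ← Real.exp_nat_mul, mul_left_comm,
    ← Real.exp_add]
  congr 2
  push_cast
  ring

theorem integral_pow_div_sinh {i : ℕ} (hi : 1 ≤ i) :
    IntegrableOn (fun x : ℝ => x ^ i / Real.sinh x) (Ioi 0) ∧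
    ∫ x in Ioi (0 : ℝ), x ^ i / Real.sinh x =
      2 * (i.factorial : ℝ) * ∑' n : ℕ, 1 / (2 * (n : ℝ) + 1) ^ (i + 1) := by
  have h := hasSum_integral_pow_mul (c := fun _ => 1) (by simp) (fun x hx => hasSum_inv_sinh hx) hi
  have h2 := h.tsum_eq
  rw [tsum_mul_left] at h2
  have h3 : ∫ x in Ioi (0 : ℝ), x ^ i / Real.sinh x =
      2 * (i.factorial : ℝ) * ∑' n : ℕ, 1 / (2 * (n : ℝ) + 1) ^ (i + 1) := by
    rw [mul_assoc, h2, ← integral_const_mul]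
    congr 1
    funext x
    rw [one_div, mul_inv]
    ring
  refine ⟨Integrable.of_integral_ne_zero ?_, h3⟩
  rw [h3]
  have hpos : 0 < ∑' n : ℕ, 1 / (2 * (n : ℝ) + 1) ^ (i + 1) :=
    (summable_odd_pow hi).tsum_pos (fun n => by positivity) 0 (by norm_num)
  positivity

theorem integrableOn_pow_div_cosh (j : ℕ) :
    IntegrableOn (fun x : ℝ => x ^ j / Real.cosh x) (Ioi 0) := by
  refine ((integral_pow_mul_exp j one_pos).1.const_mul 2).mono' ?_ ?_
  · exact ((continuous_pow j).div Real.continuous_cosh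
      fun q => (Real.cosh_pos q).ne').aestronglyMeasurable
  · refine (ae_restrict_iff' measurableSet_Ioi).2 (ae_of_all _ fun x hx => ?_)
    have hx0 : (0 : ℝ) < x := hx
    have hc := Real.cosh_pos x
    rw [Real.norm_of_nonneg (by positivity), div_le_iff₀ hc, Real.cosh_eq, one_mul]
    have h4 : Real.exp x * Real.exp (-x) = 1 := by rw [← Real.exp_add]; simp
    have h5 : 2 * (x ^ j * Real.exp (-x)) * ((Real.exp x + Real.exp (-x)) / 2) =
        x ^ j + x ^ j * Real.exp (-x) ^ 2 := by linear_combination x ^ j * h4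
    rw [h5]
    have : 0 ≤ x ^ j * Real.exp (-x) ^ 2 := by positivity
    linarith

theorem integral_pow_div_cosh {j : ℕ} (hj : 1 ≤ j) :
    ∫ x in Ioi (0 : ℝ), x ^ j / Real.cosh x = 2 * (j.factorial : ℝ) * dirichletBeta (j + 1) := by
  have h := hasSum_integral_pow_mul (c := fun n => (-1) ^ n) (by simp)
    (fun x hx => hasSum_inv_cosh hx) hj
  have h2 := h.tsum_eq
  rw [tsum_mul_left] at h2
  rw [dirichletBeta, mul_assoc, h2, ← integral_const_mul]
  congr 1
  funext x
  rw [one_div, mul_inv]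
  ring

/-! ### Moments of the kernels -/

theorem altKernel_one_eq_tanh (q : ℝ) : altKernel 1 q = Real.tanh q - Real.tanh (q / 2) := by
  rw [altKernel, Real.tanh_eq_sinh_div_cosh q, cosh_eq_tanh_half, sinh_eq_tanh_half, pow_one]
  have h1 : 1 - Real.tanh (q / 2) ^ 2 ≠ 0 := by linarith [Real.tanh_sq_lt_one (q / 2)]
  have h2 : 1 + Real.tanh (q / 2) ^ 2 ≠ 0 := by positivity
  field_simp
  ring

/-- The second term is a dilation of the first, so the moments of this kernel reduce to those of `1
/ sinh`. -/
theorem altKernel_one_eq_sinh {q : ℝ} (hq : 0 < q) :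
    altKernel 1 q = 1 / Real.sinh q - 2 / Real.sinh (2 * q) := by
  rw [Real.sinh_two_mul, altKernel, cosh_eq_tanh_half, sinh_eq_tanh_half, pow_one]
  have h1 : 1 - Real.tanh (q / 2) ^ 2 ≠ 0 := by linarith [Real.tanh_sq_lt_one (q / 2)]
  have h2 : 1 + Real.tanh (q / 2) ^ 2 ≠ 0 := by positivity
  have h3 : Real.tanh (q / 2) ≠ 0 := (tanh_pos (half_pos hq)).ne'
  field_simp
  ring

theorem altKernel_neg (e : ℕ) (q : ℝ) : altKernel e (-q) = (-1) ^ e * altKernel e q := by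
  rw [altKernel, altKernel, Real.cosh_neg, neg_div, Real.tanh_neg, neg_pow, mul_div_assoc]

theorem integrableOn_pow_mul_altKernel (e j : ℕ) :
    IntegrableOn (fun q : ℝ => q ^ j * altKernel e q) (Ioi 0) := by
  refine (integrableOn_pow_div_cosh j).mono' ?_ ?_
  · exact ((continuous_pow j).mul (continuous_altKernel e)).aestronglyMeasurable
  · refine (ae_restrict_iff' measurableSet_Ioi).2 (ae_of_all _ fun x hx => ?_)
    have hx0 : (0 : ℝ) < x := hx
    have hc := Real.cosh_pos x
    have hτ := tanh_half_mem hx0.le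
    rw [altKernel, Real.norm_of_nonneg (by have := hτ.1; positivity), mul_div_assoc']
    gcongr
    exact mul_le_of_le_one_right (by positivity) (pow_le_one₀ hτ.1 hτ.2.le)

theorem integral_pow_mul_altKernel_one {j : ℕ} (hj : 1 ≤ j) :
    ∫ q in Ioi (0 : ℝ), q ^ j * altKernel 1 q =
      (1 - 1 / 2 ^ j) * ∫ x in Ioi (0 : ℝ), x ^ j / Real.sinh x := by
  have hi := (integral_pow_div_sinh hj).1
  have hi2 : IntegrableOn (fun q : ℝ => (2 * q) ^ j / Real.sinh (2 * q)) (Ioi 0) := by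
    have := (integrableOn_Ioi_comp_mul_left_iff (fun x : ℝ => x ^ j / Real.sinh x) 0 two_pos).2
      (by rwa [mul_zero])
    exact this
  have hs := integral_comp_mul_left_Ioi (fun x : ℝ => x ^ j / Real.sinh x) 0
    (two_pos : (0 : ℝ) < 2)
  rw [mul_zero] at hs
  have heq : ∫ q in Ioi (0 : ℝ), q ^ j * altKernel 1 q =
      ∫ q in Ioi (0 : ℝ), (q ^ j / Real.sinh q -
        2 / 2 ^ j * ((2 * q) ^ j / Real.sinh (2 * q))) := by
    refine setIntegral_congr_fun measurableSet_Ioi fun q hq => ?_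
    rw [altKernel_one_eq_sinh hq, mul_pow]
    have : Real.sinh q ≠ 0 := (Real.sinh_pos_iff.2 hq).ne'
    have : Real.sinh (2 * q) ≠ 0 := (Real.sinh_pos_iff.2 (mul_pos two_pos hq)).ne'
    field_simp
  rw [heq, integral_sub hi (hi2.const_mul _), integral_const_mul, hs, smul_eq_mul]
  ring

/-- The case `j = 0`, where splitting into two `1 / sinh` terms would diverge at 0; the primitive
`log (1 + tanh² (q/2))` is used instead. -/
theorem integral_altKernel_one : ∫ q in Ioi (0 : ℝ), altKernel 1 q = Real.log 2 := by
  have hd : ∀ q ∈ Ici (0 : ℝ), HasDerivAt (fun q => Real.log (1 + Real.tanh (q / 2) ^ 2))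
      (altKernel 1 q) q := by
    intro q _
    have h2 : 1 + Real.tanh (q / 2) ^ 2 ≠ 0 := by positivity
    have h1 : 1 - Real.tanh (q / 2) ^ 2 ≠ 0 := by linarith [Real.tanh_sq_lt_one (q / 2)]
    refine ((((hasDerivAt_tanh_half q).pow 2).const_add 1).log h2).congr_deriv ?_
    rw [altKernel, cosh_eq_tanh_half]
    simp only [pow_one, Pi.pow_apply]
    field_simp
    simp
  have hlim : Tendsto (fun q : ℝ => Real.log (1 + Real.tanh (q / 2) ^ 2)) atTop
      (𝓝 (Real.log 2)) := by
    have h1 : Tendsto (fun p : ℝ => Real.tanh (p / 2)) atTop (𝓝 1) :=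
      tendsto_tanh_atTop.comp (tendsto_id.atTop_div_const two_pos)
    have h2 := (h1.pow 2).const_add 1
    norm_num at h2
    exact h2.log (by norm_num)
  have hi := integrableOn_pow_mul_altKernel 1 0
  simp only [pow_zero, one_mul] at hi
  rw [integral_Ioi_of_hasDerivAt_of_tendsto' hd hi hlim]
  simp

/-! ### The reflection identity -/

theorem integral_Ioi_comp_add (f : ℝ → ℝ) (a c : ℝ) :
    ∫ x in Ioi a, f (x + c) = ∫ x in Ioi (a + c), f x := by
  have h := (measurePreserving_add_right volume c).setIntegral_preimage_emb
    (measurableEmbedding_addRight c) f (Ioi (a + c))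
  rw [← h]
  congr 2
  ext x
  simp

theorem integrableOn_Ioi_comp_add {f : ℝ → ℝ} {a c : ℝ} (h : IntegrableOn f (Ioi (a + c))) :
    IntegrableOn (fun x => f (x + c)) (Ioi a) := by
  have := ((measurePreserving_add_right volume c).integrableOn_comp_preimage
    (measurableEmbedding_addRight c) (s := Ioi (a + c))).2 h
  refine this.mono_set ?_
  intro x hx
  simpa using hx

theorem IntegrableOn.Ioi_of_continuous {f : ℝ → ℝ} (hf : Continuous f) {a : ℝ}
    (h : IntegrableOn f (Ioi a)) (b : ℝ) : IntegrableOn f (Ioi b) := by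
  have : Ioi b ⊆ Icc b a ∪ Ioi a := by
    intro x hx
    rcases le_or_gt x a with h1 | h1
    · exact Or.inl ⟨le_of_lt hx, h1⟩
    · exact Or.inr h1
  exact ((hf.continuousOn.integrableOn_Icc).union h).mono_set this

theorem add_pow_mul_altKernel (e k : ℕ) (a b q : ℝ) :
    (a + b * q) ^ k * altKernel e q =
      ∑ j ∈ Finset.range (k + 1), a ^ (k - j) * b ^ j * k.choose j * (q ^ j * altKernel e q) := by
  rw [add_comm, add_pow, Finset.sum_mul]
  refine Finset.sum_congr rfl fun j _ => ?_
  rw [mul_pow]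
  ring

theorem integrableOn_add_pow_mul_altKernel (e k : ℕ) (a b c : ℝ) :
    IntegrableOn (fun q : ℝ => (a + b * q) ^ k * altKernel e q) (Ioi c) := by
  have hc := continuous_altKernel e
  refine IntegrableOn.Ioi_of_continuous (a := 0) (by fun_prop) ?_ c
  simp_rw [add_pow_mul_altKernel]
  exact integrable_finsetSum _ fun j _ => (integrableOn_pow_mul_altKernel e j).const_mul _

theorem integral_add_pow_mul_altKernel (e k : ℕ) (a b : ℝ) :
    ∫ q in Ioi (0 : ℝ), (a + b * q) ^ k * altKernel e q =
      ∑ j ∈ Finset.range (k + 1), a ^ (k - j) * b ^ j * k.choose j *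
        ∫ q in Ioi (0 : ℝ), q ^ j * altKernel e q := by
  simp_rw [add_pow_mul_altKernel]
  rw [integral_finsetSum _ fun j _ => (integrableOn_pow_mul_altKernel e j).const_mul _]
  simp_rw [integral_const_mul]

theorem integrableOn_pow_mul_altKernel_add (e k : ℕ) (c : ℝ) :
    IntegrableOn (fun x => x ^ k * altKernel e (x + c)) (Ioi 0) := by
  have := integrableOn_Ioi_comp_add (a := 0) (c := c)
    (integrableOn_add_pow_mul_altKernel e k (-c) 1 (0 + c))
  refine this.congr_fun (fun x _ => ?_) measurableSet_Ioi
  simp only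
  ring

/-- The reflection identity behind the parity theorem. -/
theorem two_mul_integral_sub_pow {e k : ℕ} (hk : (-1 : ℝ) ^ k = (-1) ^ e) {p : ℝ} :
    2 * ∫ q in 0..p, (p - q) ^ k * altKernel e q =
      (-1) ^ e * (∫ x in Ioi (0 : ℝ), x ^ k * (altKernel e (x - p) - altKernel e (x + p))) -
        ((-1) ^ e * (∫ q in Ioi (0 : ℝ), (p + 1 * q) ^ k * altKernel e q) -
          ∫ q in Ioi (0 : ℝ), (p + (-1) * q) ^ k * altKernel e q) := by
  have hε : ((-1 : ℝ) ^ e) * (-1) ^ e = 1 := by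
    rw [← mul_pow]; norm_num
  have hI := integrableOn_add_pow_mul_altKernel e k
  have hc := continuous_altKernel e
  -- Shift to `(-p, ∞)` and split at 0; the parity of the kernel folds `[-p, 0]` onto `[0, p]`.
  have h1 : ∫ x in Ioi (0 : ℝ), x ^ k * altKernel e (x - p) =
      (-1) ^ e * (∫ q in 0..p, (p - q) ^ k * altKernel e q) +
        ∫ q in Ioi (0 : ℝ), (p + 1 * q) ^ k * altKernel e q := by
    have h := integral_Ioi_comp_add (fun q => (p + 1 * q) ^ k * altKernel e q) 0 (-p)
    rw [zero_add, ← intervalIntegral.integral_interval_add_Ioi (b := 0) (hI _ _ _) (hI _ _ _)] at h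
    have h2 : ∫ x in Ioi (0 : ℝ), x ^ k * altKernel e (x - p) =
        ∫ x in Ioi (0 : ℝ), (p + 1 * (x + -p)) ^ k * altKernel e (x + -p) := by
      congr 1
      funext x
      rw [← sub_eq_add_neg]
      ring_nf
    rw [h2, h]
    congr 1
    have h3 := intervalIntegral.integral_comp_neg (a := 0) (b := p)
      (fun q => (p + 1 * q) ^ k * altKernel e q)
    rw [neg_zero] at h3
    rw [← h3, ← intervalIntegral.integral_const_mul]
    congr 1
    funext q
    rw [altKernel_neg]
    ring
  -- Shift to `(p, ∞)`, the half-line minus `[0, p]`; the parity of `k` turns `(p - q)^k` into `(q -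
  -- p)^k` up to `(-1)^e`.
  have h2 : ∫ x in Ioi (0 : ℝ), x ^ k * altKernel e (x + p) =
      (-1) ^ e * (∫ q in Ioi (0 : ℝ), (p + (-1) * q) ^ k * altKernel e q) -
        (-1) ^ e * ∫ q in 0..p, (p - q) ^ k * altKernel e q := by
    have h := integral_Ioi_comp_add (fun q => (p + (-1) * q) ^ k * altKernel e q) 0 p
    rw [zero_add] at h
    rw [← intervalIntegral.integral_interval_add_Ioi (a := 0) (b := p) (hI _ _ _) (hI _ _ _), ← h]
    have h3 : ∫ x in Ioi (0 : ℝ), (p + (-1) * (x + p)) ^ k * altKernel e (x + p) =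
        (-1) ^ e * ∫ x in Ioi (0 : ℝ), x ^ k * altKernel e (x + p) := by
      rw [← integral_const_mul]
      congr 1
      funext x
      rw [show p + (-1) * (x + p) = -x by ring, neg_pow, hk]
      ring
    have h4 : ∫ q in 0..p, (p + (-1) * q) ^ k * altKernel e q =
        ∫ q in 0..p, (p - q) ^ k * altKernel e q := by
      congr 1
      funext q
      ring
    rw [h3, h4, mul_add, ← mul_assoc ((-1) ^ e) ((-1) ^ e), hε]
    ring
  have h3 : ∫ x in Ioi (0 : ℝ), x ^ k * (altKernel e (x - p) - altKernel e (x + p)) =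
      (∫ x in Ioi (0 : ℝ), x ^ k * altKernel e (x - p)) -
        ∫ x in Ioi (0 : ℝ), x ^ k * altKernel e (x + p) := by
    rw [← integral_sub]
    · simp_rw [mul_sub]
    · have := integrableOn_pow_mul_altKernel_add e k (-p)
      simp only [← sub_eq_add_neg] at this
      exact this
    · exact integrableOn_pow_mul_altKernel_add e k p
  rw [h3, h1, h2]
  linear_combination (-2 * (∫ q in 0..p, (p - q) ^ k * altKernel e q) +
    ∫ q in Ioi (0 : ℝ), (p + (-1) * q) ^ k * altKernel e q) * hε

/-- The part of the reflection identity that separates into products of moments. -/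
theorem integral_separated {e k : ℕ} (hk : (-1 : ℝ) ^ k = (-1) ^ e) :
    IntegrableOn (fun p => ((-1) ^ e * (∫ q in Ioi (0 : ℝ), (p + 1 * q) ^ k * altKernel e q) -
          ∫ q in Ioi (0 : ℝ), (p + (-1) * q) ^ k * altKernel e q) / Real.sinh p) (Ioi 0) ∧
    ∫ p in Ioi (0 : ℝ), ((-1) ^ e * (∫ q in Ioi (0 : ℝ), (p + 1 * q) ^ k * altKernel e q) -
          ∫ q in Ioi (0 : ℝ), (p + (-1) * q) ^ k * altKernel e q) / Real.sinh p =
      ∑ j ∈ Finset.range k, ((-1) ^ e - (-1) ^ j) * k.choose j *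
        (∫ q in Ioi (0 : ℝ), q ^ j * altKernel e q) *
          ∫ p in Ioi (0 : ℝ), p ^ (k - j) / Real.sinh p := by
  have h : ∀ p : ℝ, ((-1) ^ e * (∫ q in Ioi (0 : ℝ), (p + 1 * q) ^ k * altKernel e q) -
          ∫ q in Ioi (0 : ℝ), (p + (-1) * q) ^ k * altKernel e q) / Real.sinh p =
      ∑ j ∈ Finset.range k, ((-1) ^ e - (-1) ^ j) * k.choose j *
        (∫ q in Ioi (0 : ℝ), q ^ j * altKernel e q) * (p ^ (k - j) / Real.sinh p) := by
    intro p
    rw [integral_add_pow_mul_altKernel, integral_add_pow_mul_altKernel, Finset.mul_sum,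
      ← Finset.sum_sub_distrib, Finset.sum_range_succ, hk, one_pow]
    -- The term `j = k`, constant in `p`, cancels by parity; otherwise `1 / sinh p` would be
    -- non-integrable at 0.
    have hlast : ∀ μ : ℝ, (-1) ^ e * (p ^ (k - k) * 1 * (k.choose k : ℝ) * μ) -
        p ^ (k - k) * (-1) ^ e * (k.choose k : ℝ) * μ = 0 := fun μ => by ring
    rw [hlast, add_zero, Finset.sum_div]
    refine Finset.sum_congr rfl fun j _ => ?_
    rw [one_pow]
    ring
  have hi : ∀ j ∈ Finset.range k,
      IntegrableOn (fun p : ℝ => p ^ (k - j) / Real.sinh p) (Ioi 0) := fun j hj =>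
    (integral_pow_div_sinh (by have := Finset.mem_range.1 hj; omega)).1
  simp_rw [h]
  refine ⟨integrable_finsetSum _ fun j hj => (hi j hj).const_mul _, ?_⟩
  rw [integral_finsetSum _ fun j hj => (hi j hj).const_mul _]
  simp_rw [integral_const_mul]

/-! ### The reflected part, by Tonelli and addition formulas -/

theorem integral_swap_of_nonneg {K : ℝ → ℝ → ℝ} (hK : Measurable (Function.uncurry K))
    (hpos : ∀ x, 0 < x → ∀ p, 0 < p → 0 ≤ K x p) {r : ℝ → ℝ}
    (hi : ∀ x, 0 < x → IntegrableOn (K x) (Ioi 0))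
    (hr : ∀ x, 0 < x → ∫ p in Ioi (0 : ℝ), K x p = r x) (hri : IntegrableOn r (Ioi 0)) :
    IntegrableOn (fun p => ∫ x in Ioi (0 : ℝ), K x p) (Ioi 0) ∧
      ∫ p in Ioi (0 : ℝ), ∫ x in Ioi (0 : ℝ), K x p = ∫ x in Ioi (0 : ℝ), r x ∧
      ∀ᵐ p ∂volume.restrict (Ioi (0 : ℝ)), IntegrableOn (fun x => K x p) (Ioi 0) := by
  have hint : Integrable (Function.uncurry K)
      ((volume.restrict (Ioi (0 : ℝ))).prod (volume.restrict (Ioi (0 : ℝ)))) := by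
    rw [integrable_prod_iff hK.aestronglyMeasurable]
    refine ⟨(ae_restrict_iff' measurableSet_Ioi).2 (ae_of_all _ fun x hx => hi x hx), ?_⟩
    refine hri.congr_fun (fun x hx => ?_) measurableSet_Ioi
    rw [← hr x hx]
    refine setIntegral_congr_fun measurableSet_Ioi fun p hp => ?_
    exact (Real.norm_of_nonneg (hpos x hx p hp)).symm
  refine ⟨hint.integral_prod_right, ?_, hint.prod_left_ae⟩
  rw [← integral_integral_swap hint]
  exact setIntegral_congr_fun measurableSet_Ioi fun x hx => hr x hx

theorem tendsto_log_cosh_sub : Tendsto (fun y => Real.log (Real.cosh y) - y) atTop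
    (𝓝 (Real.log (1 / 2))) := by
  have h : (fun y => Real.log (Real.cosh y) - y) =
      fun y => Real.log ((1 + Real.exp (-2 * y)) / 2) := by
    funext y
    have h1 : Real.cosh y = (1 + Real.exp (-2 * y)) / 2 * Real.exp y := by
      rw [Real.cosh_eq, div_mul_eq_mul_div, add_mul, ← Real.exp_add]
      ring_nf
    rw [h1, Real.log_mul (by positivity) (Real.exp_pos y).ne', Real.log_exp]
    ring
  rw [h]
  have h2 : Tendsto (fun y : ℝ => Real.exp (-2 * y)) atTop (𝓝 0) :=
    Real.tendsto_exp_atBot.comp (tendsto_id.const_mul_atTop_of_neg (by norm_num))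
  have h3 := (h2.const_add 1).div_const 2
  rw [add_zero] at h3
  exact h3.log (by norm_num)

/-- The primitive is `log cosh (p + x) - log cosh (p - x)`, and `log cosh y - y` has a limit at
infinity, so only `2 * x` remains; at `p = 0` the primitive vanishes. -/
theorem integral_tanh_sub_tanh {x : ℝ} (hx : 0 < x) :
    IntegrableOn (fun p => Real.tanh (p + x) - Real.tanh (p - x)) (Ioi 0) ∧
      ∫ p in Ioi (0 : ℝ), (Real.tanh (p + x) - Real.tanh (p - x)) = 2 * x := by
  have hlc : ∀ y : ℝ, HasDerivAt (fun y => Real.log (Real.cosh y)) (Real.tanh y) y := by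
    intro y
    rw [Real.tanh_eq_sinh_div_cosh]
    exact (Real.hasDerivAt_cosh y).log (Real.cosh_pos y).ne'
  have hd : ∀ p ∈ Ici (0 : ℝ), HasDerivAt
      (fun p => Real.log (Real.cosh (p + x)) - Real.log (Real.cosh (p - x)))
      (Real.tanh (p + x) - Real.tanh (p - x)) p := fun p _ =>
    ((hlc (p + x)).comp_add_const p x).sub ((hlc (p - x)).comp_sub_const p x)
  have hpos : ∀ p ∈ Ioi (0 : ℝ), 0 ≤ Real.tanh (p + x) - Real.tanh (p - x) := fun p _ =>
    sub_nonneg.2 (monotone_tanh (by linarith))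
  have hlim : Tendsto (fun p => Real.log (Real.cosh (p + x)) - Real.log (Real.cosh (p - x))) atTop
      (𝓝 (2 * x)) := by
    have h1 := tendsto_log_cosh_sub.comp (tendsto_atTop_add_const_right atTop x tendsto_id)
    have h2 := tendsto_log_cosh_sub.comp (tendsto_atTop_add_const_right atTop (-x) tendsto_id)
    have h3 := (h1.sub h2).add_const (2 * x)
    rw [sub_self, zero_add] at h3
    refine h3.congr fun p => ?_
    simp only [Function.comp_apply, id]
    rw [← sub_eq_add_neg]
    ring
  refine ⟨integrableOn_Ioi_deriv_of_nonneg' hd hpos hlim, ?_⟩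
  rw [integral_Ioi_of_hasDerivAt_of_nonneg' hd hpos hlim]
  simp

/-- The primitive of `1 / cosh` is `arctan ∘ sinh`; being odd, it makes the contributions at `p = 0`
cancel. -/
theorem integral_inv_cosh_add {x : ℝ} :
    IntegrableOn (fun p => 1 / Real.cosh (p - x) + 1 / Real.cosh (p + x)) (Ioi 0) ∧
      ∫ p in Ioi (0 : ℝ), (1 / Real.cosh (p - x) + 1 / Real.cosh (p + x)) = Real.pi := by
  have hat : ∀ y : ℝ, HasDerivAt (fun y => Real.arctan (Real.sinh y)) (1 / Real.cosh y) y := by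
    intro y
    refine (Real.hasDerivAt_sinh y).arctan.congr_deriv ?_
    have := (Real.cosh_pos y).ne'
    rw [← Real.cosh_sq']
    field_simp
  have hd : ∀ p ∈ Ici (0 : ℝ), HasDerivAt
      (fun p => Real.arctan (Real.sinh (p - x)) + Real.arctan (Real.sinh (p + x)))
      (1 / Real.cosh (p - x) + 1 / Real.cosh (p + x)) p := fun p _ =>
    ((hat (p - x)).comp_sub_const p x).add ((hat (p + x)).comp_add_const p x)
  have hpos : ∀ p ∈ Ioi (0 : ℝ), 0 ≤ 1 / Real.cosh (p - x) + 1 / Real.cosh (p + x) := by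
    intro p _
    have := Real.cosh_pos (p - x)
    have := Real.cosh_pos (p + x)
    positivity
  have hs : Tendsto Real.sinh atTop atTop := by
    refine tendsto_atTop_mono' atTop ?_ tendsto_id
    filter_upwards [eventually_ge_atTop 0] with y hy using Real.self_le_sinh_iff.2 hy
  have hat' : Tendsto (fun y => Real.arctan (Real.sinh y)) atTop (𝓝 (Real.pi / 2)) :=
    (tendsto_nhds_of_tendsto_nhdsWithin Real.tendsto_arctan_atTop).comp hs
  have hlim : Tendsto (fun p => Real.arctan (Real.sinh (p - x)) + Real.arctan (Real.sinh (p + x)))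
      atTop (𝓝 Real.pi) := by
    have h1 := hat'.comp (tendsto_atTop_add_const_right atTop x tendsto_id)
    have h2 := hat'.comp (tendsto_atTop_add_const_right atTop (-x) tendsto_id)
    have h3 := h2.add h1
    rw [add_halves] at h3
    exact h3
  refine ⟨integrableOn_Ioi_deriv_of_nonneg' hd hpos hlim, ?_⟩
  rw [integral_Ioi_of_hasDerivAt_of_nonneg' hd hpos hlim]
  simp

theorem reflected_kernel_zero (x : ℝ) {p : ℝ} (hp : 0 < p) :
    (altKernel 0 (x - p) - altKernel 0 (x + p)) / Real.sinh p =
      1 / Real.cosh x * (Real.tanh (p + x) - Real.tanh (p - x)) := by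
  have hs : Real.sinh p ≠ 0 := (Real.sinh_pos_iff.2 hp).ne'
  have h1 := (Real.cosh_pos (p + x)).ne'
  have h2 := (Real.cosh_pos (p - x)).ne'
  have h3 := (Real.cosh_pos x).ne'
  rw [altKernel, altKernel, pow_zero, pow_zero, ← neg_sub p x, Real.cosh_neg, add_comm x p,
    Real.tanh_eq_sinh_div_cosh, Real.tanh_eq_sinh_div_cosh]
  field_simp
  rw [Real.cosh_add, Real.cosh_sub, Real.sinh_add, Real.sinh_sub]
  have h4 := Real.cosh_sq p
  ring_nf
  rw [h4]
  ring

/-- Write the kernel as `tanh q - tanh (q / 2)`. Each half is a sum `tanh a + tanh b` with `a + b`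
equal to `2 * p` or `p`, so the addition formula produces a factor `sinh p`. -/
theorem reflected_kernel_one {x p : ℝ} (hx : 0 < x) (hp : 0 < p) :
    (altKernel 1 (x - p) - altKernel 1 (x + p)) / Real.sinh p =
      1 / Real.sinh x * (Real.tanh ((p + x) / 2) - Real.tanh ((p - x) / 2)) -
        1 / Real.cosh x * (1 / Real.cosh (p - x) + 1 / Real.cosh (p + x)) := by
  have hs : Real.sinh p ≠ 0 := (Real.sinh_pos_iff.2 hp).ne'
  have hsx : Real.sinh x ≠ 0 := (Real.sinh_pos_iff.2 hx).ne'
  have h1 := (Real.cosh_pos (p + x)).ne'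
  have h2 := (Real.cosh_pos (p - x)).ne'
  have h3 := (Real.cosh_pos x).ne'
  have hA : Real.tanh (p - x) + Real.tanh (p + x) =
      Real.sinh p * (1 / Real.cosh x * (1 / Real.cosh (p - x) + 1 / Real.cosh (p + x))) := by
    rw [Real.tanh_eq_sinh_div_cosh, Real.tanh_eq_sinh_div_cosh]
    field_simp
    rw [Real.cosh_add, Real.cosh_sub, Real.sinh_add, Real.sinh_sub]
    linear_combination 2 * Real.sinh p * Real.cosh x * Real.cosh p * Real.cosh_sq x
  have hB : ∀ a b : ℝ, Real.sinh (a - b) * (Real.tanh a + Real.tanh b) =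
      Real.sinh (a + b) * (Real.tanh a - Real.tanh b) := by
    intro a b
    have := (Real.cosh_pos a).ne'
    have := (Real.cosh_pos b).ne'
    rw [Real.tanh_eq_sinh_div_cosh, Real.tanh_eq_sinh_div_cosh, Real.sinh_add, Real.sinh_sub]
    field_simp
  have hC := hB ((p + x) / 2) ((p - x) / 2)
  rw [show (p + x) / 2 - (p - x) / 2 = x by ring, show (p + x) / 2 + (p - x) / 2 = p by ring] at hC
  rw [altKernel_one_eq_tanh, altKernel_one_eq_tanh, ← neg_sub p x, Real.tanh_neg, neg_div,
    Real.tanh_neg, add_comm x p]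
  rw [div_eq_iff hs]
  have hD : Real.tanh ((p + x) / 2) + Real.tanh ((p - x) / 2) = Real.sinh p *
      (1 / Real.sinh x * (Real.tanh ((p + x) / 2) - Real.tanh ((p - x) / 2))) := by
    field_simp
    linear_combination hC
  linear_combination hD - hA

theorem integral_reflected_zero (k : ℕ) :
    IntegrableOn (fun p => (∫ x in Ioi (0 : ℝ), x ^ k * (altKernel 0 (x - p) - altKernel 0 (x + p)))
      / Real.sinh p) (Ioi 0) ∧
    ∫ p in Ioi (0 : ℝ), (∫ x in Ioi (0 : ℝ), x ^ k * (altKernel 0 (x - p) - altKernel 0 (x + p)))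
      / Real.sinh p = 2 * ∫ x in Ioi (0 : ℝ), x ^ (k + 1) / Real.cosh x := by
  have hct := continuous_tanh
  have hcc := Real.continuous_cosh
  have h := integral_swap_of_nonneg
    (K := fun x p => x ^ k / Real.cosh x * (Real.tanh (p + x) - Real.tanh (p - x)))
    (r := fun x => 2 * (x ^ (k + 1) / Real.cosh x)) ?_ ?_ ?_ ?_ ?_
  · have heq : ∀ p ∈ Ioi (0 : ℝ), ∫ x in Ioi (0 : ℝ),
        x ^ k / Real.cosh x * (Real.tanh (p + x) - Real.tanh (p - x)) =
        (∫ x in Ioi (0 : ℝ), x ^ k * (altKernel 0 (x - p) - altKernel 0 (x + p))) /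
          Real.sinh p := by
      intro p hp
      rw [← integral_div]
      congr 1
      funext x
      rw [mul_div_assoc, reflected_kernel_zero x hp]
      ring
    refine ⟨h.1.congr_fun heq measurableSet_Ioi, ?_⟩
    rw [← setIntegral_congr_fun measurableSet_Ioi heq, h.2.1, integral_const_mul]
  · have : Continuous (Function.uncurry fun x p : ℝ =>
        x ^ k / Real.cosh x * (Real.tanh (p + x) - Real.tanh (p - x))) := by
      unfold Function.uncurry
      refine Continuous.mul ?_ (by fun_prop)
      exact (by fun_prop : Continuous fun z : ℝ × ℝ => z.1 ^ k).div (by fun_prop)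
        fun z => (Real.cosh_pos z.1).ne'
    exact this.measurable
  · intro x hx p _
    have := Real.cosh_pos x
    exact mul_nonneg (by positivity) (sub_nonneg.2 (monotone_tanh (by linarith)))
  · intro x hx
    exact (integral_tanh_sub_tanh hx).1.const_mul _
  · intro x hx
    rw [integral_const_mul, (integral_tanh_sub_tanh hx).2]
    ring
  · exact (integrableOn_pow_div_cosh (k + 1)).const_mul 2

theorem integral_tanh_half_sub_tanh_half {x : ℝ} (hx : 0 < x) :
    IntegrableOn (fun p => Real.tanh ((p + x) / 2) - Real.tanh ((p - x) / 2)) (Ioi 0) ∧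
      ∫ p in Ioi (0 : ℝ), (Real.tanh ((p + x) / 2) - Real.tanh ((p - x) / 2)) = 2 * x := by
  have h := integral_tanh_sub_tanh (half_pos hx)
  have hc : (fun p => Real.tanh ((p + x) / 2) - Real.tanh ((p - x) / 2)) = fun p =>
      (fun p => Real.tanh (p + x / 2) - Real.tanh (p - x / 2)) (1 / 2 * p) := by
    funext p
    simp only
    congr 2 <;> ring
  rw [hc]
  constructor
  · refine (integrableOn_Ioi_comp_mul_left_iff
      (fun p => Real.tanh (p + x / 2) - Real.tanh (p - x / 2)) 0 one_half_pos).2 ?_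
    rw [mul_zero]
    exact h.1
  · rw [integral_comp_mul_left_Ioi (fun p => Real.tanh (p + x / 2) - Real.tanh (p - x / 2)) 0
      one_half_pos, mul_zero, h.2, smul_eq_mul]
    ring

theorem integral_reflected_one {k : ℕ} (hk : 1 ≤ k) :
    IntegrableOn (fun p => (∫ x in Ioi (0 : ℝ), x ^ k * (altKernel 1 (x - p) - altKernel 1 (x + p)))
      / Real.sinh p) (Ioi 0) ∧
    ∫ p in Ioi (0 : ℝ), (∫ x in Ioi (0 : ℝ), x ^ k * (altKernel 1 (x - p) - altKernel 1 (x + p)))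
      / Real.sinh p = 2 * (∫ x in Ioi (0 : ℝ), x ^ (k + 1) / Real.sinh x) -
        Real.pi * ∫ x in Ioi (0 : ℝ), x ^ k / Real.cosh x := by
  have hct := continuous_tanh
  have hcc := Real.continuous_cosh
  have hcs := Real.continuous_sinh
  have hmeas1 : Measurable (Function.uncurry fun x p : ℝ =>
      x ^ k / Real.sinh x * (Real.tanh ((p + x) / 2) - Real.tanh ((p - x) / 2))) := by
    unfold Function.uncurry
    refine Measurable.mul ?_ (Continuous.measurable (by fun_prop))
    exact (by fun_prop : Continuous fun z : ℝ × ℝ => z.1 ^ k).measurable.div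
      (by fun_prop : Continuous fun z : ℝ × ℝ => Real.sinh z.1).measurable
  have hmeas2 : Measurable (Function.uncurry fun x p : ℝ =>
      x ^ k / Real.cosh x * (1 / Real.cosh (p - x) + 1 / Real.cosh (p + x))) := by
    unfold Function.uncurry
    have hcosh : Continuous fun y : ℝ => 1 / Real.cosh y :=
      continuous_const.div Real.continuous_cosh fun y => (Real.cosh_pos y).ne'
    refine Measurable.mul ?_ (Continuous.measurable (Continuous.add
      (hcosh.comp (by fun_prop : Continuous fun z : ℝ × ℝ => z.2 - z.1))
      (hcosh.comp (by fun_prop : Continuous fun z : ℝ × ℝ => z.2 + z.1))))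
    exact (by fun_prop : Continuous fun z : ℝ × ℝ => z.1 ^ k).measurable.div
      (by fun_prop : Continuous fun z : ℝ × ℝ => Real.cosh z.1).measurable
  have h1 := integral_swap_of_nonneg hmeas1 (r := fun x => 2 * (x ^ (k + 1) / Real.sinh x))
    (fun x hx p hp => by
      have := Real.sinh_pos_iff.2 hx
      exact mul_nonneg (by positivity) (sub_nonneg.2 (monotone_tanh (by linarith))))
    (fun x hx => (integral_tanh_half_sub_tanh_half hx).1.const_mul _)
    (fun x hx => by
      rw [integral_const_mul, (integral_tanh_half_sub_tanh_half hx).2]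
      ring)
    ((integral_pow_div_sinh (by omega)).1.const_mul 2)
  have h2 := integral_swap_of_nonneg hmeas2 (r := fun x => Real.pi * (x ^ k / Real.cosh x))
    (fun x hx p hp => by
      have := Real.cosh_pos x
      have := Real.cosh_pos (p - x)
      have := Real.cosh_pos (p + x)
      positivity)
    (fun x hx => integral_inv_cosh_add.1.const_mul _)
    (fun x hx => by
      rw [integral_const_mul, integral_inv_cosh_add.2]
      ring)
    ((integrableOn_pow_div_cosh k).const_mul _)
  have heq : ∀ᵐ p ∂volume.restrict (Ioi (0 : ℝ)),
      (∫ x in Ioi (0 : ℝ),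
        x ^ k / Real.sinh x * (Real.tanh ((p + x) / 2) - Real.tanh ((p - x) / 2))) -
      (∫ x in Ioi (0 : ℝ),
        x ^ k / Real.cosh x * (1 / Real.cosh (p - x) + 1 / Real.cosh (p + x))) =
      (∫ x in Ioi (0 : ℝ), x ^ k * (altKernel 1 (x - p) - altKernel 1 (x + p))) / Real.sinh p := by
    -- The two pieces are subtracted under the integral in `x`, which needs each to be integrable
    -- there; Fubini gives this for almost every `p`.
    filter_upwards [h1.2.2, h2.2.2, ae_restrict_mem measurableSet_Ioi] with p hp1 hp2 hp
    rw [← integral_div, ← integral_sub hp1 hp2]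
    refine setIntegral_congr_fun measurableSet_Ioi fun x hx => ?_
    rw [mul_div_assoc, reflected_kernel_one hx hp]
    ring
  refine ⟨(h1.1.sub h2.1).congr heq, ?_⟩
  rw [← integral_congr_ae heq, integral_sub h1.1 h2.1, h1.2.1, h2.2.1, integral_const_mul,
    integral_const_mul]

/-! ### Membership in the ring -/

theorem tsum_odd_pow {s : ℕ} (hs : 2 ≤ s) :
    ∑' n : ℕ, 1 / (2 * (n : ℝ) + 1) ^ s = (1 - 1 / 2 ^ s) * ∑' n : ℕ, 1 / (n : ℝ) ^ s := by
  have hsum : Summable fun n : ℕ => 1 / (n : ℝ) ^ s :=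
    Real.summable_one_div_nat_pow.2 (by omega)
  have he : Function.Injective fun i : ℕ => 2 * i := fun a b h => by simpa using h
  have ho : Function.Injective fun i : ℕ => 2 * i + 1 := fun a b h => by simpa using h
  have h := tsum_even_add_odd (f := fun n : ℕ => 1 / (n : ℝ) ^ s) (hsum.comp_injective he)
    (hsum.comp_injective ho)
  have h2 : ∑' n : ℕ, 1 / ((2 * n : ℕ) : ℝ) ^ s = 1 / 2 ^ s * ∑' n : ℕ, 1 / (n : ℝ) ^ s := by
    rw [← tsum_mul_left]
    congr 1
    funext n
    push_cast
    rw [mul_pow]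
    ring
  rw [h2] at h
  push_cast at h
  linear_combination h

theorem natCast_inv_mem (n : ℕ) : ((n : ℝ))⁻¹ ∈ logPiZetaBetaRing := by
  have := logPiZetaBetaRing.algebraMap_mem ((n : ℚ)⁻¹)
  simpa using this

theorem zeta_mem {s : ℕ} (hs : 2 ≤ s) : ∑' n : ℕ, 1 / (n : ℝ) ^ s ∈ logPiZetaBetaRing := by
  refine Algebra.subset_adjoin (Or.inl (Or.inr ⟨s, hs, ?_⟩))
  rw [zeta_nat_eq_tsum_of_gt_one (by omega), Complex.ofReal_tsum]
  simp

theorem beta_mem {s : ℕ} (hs : 2 ≤ s) : dirichletBeta s ∈ logPiZetaBetaRing :=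
  Algebra.subset_adjoin (Or.inr ⟨s, hs, rfl⟩)

theorem pi_mem : Real.pi ∈ logPiZetaBetaRing :=
  Algebra.subset_adjoin (Or.inl (Or.inl (Or.inr rfl)))

theorem log_two_mem : Real.log 2 ∈ logPiZetaBetaRing :=
  Algebra.subset_adjoin (Or.inl (Or.inl (Or.inl rfl)))

theorem ofNat_two_mem : (2 : ℝ) ∈ logPiZetaBetaRing := by
  exact_mod_cast natCast_mem logPiZetaBetaRing 2

theorem inv_two_pow_mem (s : ℕ) : 1 / (2 : ℝ) ^ s ∈ logPiZetaBetaRing := by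
  have := natCast_inv_mem (2 ^ s)
  simpa using this

theorem integral_pow_div_sinh_mem {i : ℕ} (hi : 1 ≤ i) :
    ∫ x in Ioi (0 : ℝ), x ^ i / Real.sinh x ∈ logPiZetaBetaRing := by
  rw [(integral_pow_div_sinh hi).2, tsum_odd_pow (by omega)]
  exact mul_mem (mul_mem ofNat_two_mem (natCast_mem _ _))
    (mul_mem (sub_mem (one_mem _) (inv_two_pow_mem _)) (zeta_mem (by omega)))

theorem integral_pow_div_cosh_mem {j : ℕ} (hj : 1 ≤ j) :
    ∫ x in Ioi (0 : ℝ), x ^ j / Real.cosh x ∈ logPiZetaBetaRing := by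
  rw [integral_pow_div_cosh hj]
  exact mul_mem (mul_mem ofNat_two_mem (natCast_mem _ _)) (beta_mem (by omega))

theorem integral_separated_mem {e k : ℕ} (he : e ≤ 1) :
    ∑ j ∈ Finset.range k, ((-1) ^ e - (-1) ^ j) * k.choose j *
        (∫ q in Ioi (0 : ℝ), q ^ j * altKernel e q) *
          ∫ p in Ioi (0 : ℝ), p ^ (k - j) / Real.sinh p ∈ logPiZetaBetaRing := by
  refine sum_mem fun j hj => ?_
  have hs := integral_pow_div_sinh_mem (i := k - j) (by have := Finset.mem_range.1 hj; omega)
  by_cases hpar : (-1 : ℝ) ^ e = (-1) ^ j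
  -- Only `j` of parity opposite to `e` survive. For `e = 0` this excludes `j = 0`; for `e = 1` that
  -- term is the `log 2` moment.
  · rw [hpar, sub_self, zero_mul, zero_mul, zero_mul]
    exact zero_mem _
  refine mul_mem (mul_mem (mul_mem (sub_mem ?_ ?_) (natCast_mem _ _)) ?_) hs
  · exact pow_mem (neg_mem (one_mem _)) _
  · exact pow_mem (neg_mem (one_mem _)) _
  · interval_cases e
    · have hj1 : 1 ≤ j := by
        by_contra h
        obtain rfl : j = 0 := by omega
        exact hpar rfl
      have := integral_pow_div_cosh_mem hj1
      simpa only [altKernel, pow_zero, mul_one_div] using this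
    · rcases Nat.eq_zero_or_pos j with rfl | hj1
      · simp only [pow_zero, one_mul, integral_altKernel_one]
        exact log_two_mem
      · rw [integral_pow_mul_altKernel_one hj1]
        exact mul_mem (sub_mem (one_mem _) (inv_two_pow_mem _)) (integral_pow_div_sinh_mem hj1)

theorem integral_reflected {e k : ℕ} (he : e ≤ 1) (hk : 1 ≤ k) :
    IntegrableOn (fun p => (∫ x in Ioi (0 : ℝ), x ^ k * (altKernel e (x - p) - altKernel e (x + p)))
      / Real.sinh p) (Ioi 0) ∧
    ∫ p in Ioi (0 : ℝ), (∫ x in Ioi (0 : ℝ), x ^ k * (altKernel e (x - p) - altKernel e (x + p)))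
      / Real.sinh p ∈ logPiZetaBetaRing := by
  interval_cases e
  · refine ⟨(integral_reflected_zero k).1, ?_⟩
    rw [(integral_reflected_zero k).2]
    exact mul_mem ofNat_two_mem (integral_pow_div_cosh_mem (by omega))
  · refine ⟨(integral_reflected_one hk).1, ?_⟩
    rw [(integral_reflected_one hk).2]
    exact sub_mem (mul_mem ofNat_two_mem (integral_pow_div_sinh_mem (by omega)))
      (mul_mem pi_mem (integral_pow_div_cosh_mem hk))

theorem integral_iterKernel_div_sinh {e k : ℕ} (he : e ≤ 1) (hk : 1 ≤ k)
    (hpar : (-1 : ℝ) ^ k = (-1) ^ e) :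
    IntegrableOn (fun p => iterKernel e k p / Real.sinh p) (Ioi 0) ∧
      ∫ p in Ioi (0 : ℝ), iterKernel e k p / Real.sinh p ∈ logPiZetaBetaRing := by
  have hA := integral_reflected he hk
  have hB := integral_separated hpar
  have heq : ∀ p : ℝ, iterKernel e k p / Real.sinh p = ((2 * k.factorial : ℕ) : ℝ)⁻¹ *
      ((-1) ^ e * ((∫ x in Ioi (0 : ℝ), x ^ k * (altKernel e (x - p) - altKernel e (x + p)))
        / Real.sinh p) -
        ((-1) ^ e * (∫ q in Ioi (0 : ℝ), (p + 1 * q) ^ k * altKernel e q) -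
          ∫ q in Ioi (0 : ℝ), (p + (-1) * q) ^ k * altKernel e q) / Real.sinh p) := by
    intro p
    have h := two_mul_integral_sub_pow hpar (p := p)
    have hf : (k.factorial : ℝ) ≠ 0 := by positivity
    rw [← mul_div_assoc, ← sub_div, ← h, iterKernel_eq]
    push_cast
    field_simp
  simp_rw [heq]
  refine ⟨((hA.1.const_mul _).sub hB.1).const_mul _, ?_⟩
  rw [integral_const_mul, integral_sub (hA.1.const_mul _) hB.1, integral_const_mul, hB.2]
  exact mul_mem (natCast_inv_mem _) (sub_mem (mul_mem (pow_mem (neg_mem (one_mem _)) _) hA.2)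
    (integral_separated_mem he))

/-- The sums are the partial sums, at the even cut-offs `2 * n`, of a convergent series over the
outermost denominator. -/
theorem tendsto_altSum_two {e : ℕ} (he : e ≤ 1) (j : ℕ) (hpar : (-1 : ℝ) ^ (j + 1) = (-1) ^ e) :
    ∃ x ∈ logPiZetaBetaRing, Tendsto (altSum e ((2, 1) :: onesBar j)) atTop (𝓝 x) := by
  have h := integral_iterKernel_div_sinh he (Nat.succ_pos j) hpar
  refine ⟨_, neg_mem h.2, ?_⟩
  have hsum := (hasSum_altCoeff_two he j h.1).tendsto_sum_nat
  have h2 : Tendsto (fun n : ℕ => 2 * n) atTop atTop :=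
    tendsto_id.const_mul_atTop' two_pos
  refine (hsum.comp h2).congr' ?_
  filter_upwards [eventually_ge_atTop 1] with n hn
  exact (altSum_eq_sum_range e he _ n hn).symm

theorem mainTheorem6 (m : ℕ) (hm : 1 ≤ m) :
    (Tendsto (altSSum ((2, 1) :: List.replicate (2 * m - 2) (1, 1) ++ [(1, -1)])) atTop
        (𝓝 (altS ((2, 1) :: List.replicate (2 * m - 2) (1, 1) ++ [(1, -1)]))) ∧
      altS ((2, 1) :: List.replicate (2 * m - 2) (1, 1) ++ [(1, -1)]) ∈ logPiZetaBetaRing) ∧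
    (Tendsto (altTSum ((2, 1) :: List.replicate (2 * m - 1) (1, 1) ++ [(1, -1)])) atTop
        (𝓝 (altT ((2, 1) :: List.replicate (2 * m - 1) (1, 1) ++ [(1, -1)]))) ∧
      altT ((2, 1) :: List.replicate (2 * m - 1) (1, 1) ++ [(1, -1)]) ∈ logPiZetaBetaRing) := by
  constructor
  · obtain ⟨x, hx, h⟩ := tendsto_altSum_two (e := 1) le_rfl (2 * m - 2)
      (by rw [show 2 * m - 2 + 1 = 2 * (m - 1) + 1 by omega, pow_succ, pow_mul]; simp)
    rw [← altSSum_eq_altSum] at h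
    have hlim : altS ((2, 1) :: onesBar (2 * m - 2)) = x := h.limUnder_eq
    change Tendsto (altSSum ((2, 1) :: onesBar (2 * m - 2))) atTop
      (𝓝 (altS ((2, 1) :: onesBar (2 * m - 2)))) ∧
      altS ((2, 1) :: onesBar (2 * m - 2)) ∈ logPiZetaBetaRing
    rw [hlim]
    exact ⟨h, hx⟩
  · obtain ⟨x, hx, h⟩ := tendsto_altSum_two (e := 0) zero_le_one (2 * m - 1)
      (by rw [show 2 * m - 1 + 1 = 2 * m by omega, pow_mul]; simp)
    rw [← altTSum_eq_altSum] at h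
    have hlim : altT ((2, 1) :: onesBar (2 * m - 1)) = x := h.limUnder_eq
    change Tendsto (altTSum ((2, 1) :: onesBar (2 * m - 1))) atTop
      (𝓝 (altT ((2, 1) :: onesBar (2 * m - 1)))) ∧
      altT ((2, 1) :: onesBar (2 * m - 1)) ∈ logPiZetaBetaRing
    rw [hlim]
    exact ⟨h, hx⟩
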